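/- **Setting.** All systems are finite-dimensional and of odd dimension: each is a (possibly empty) tensor product of qudits of odd prime dimension; logarithms are in base two. For a qudit of odd prime dimension $d$ let $X|j\rangle=|j+1 \bmod d\rangle$, $Z|j\rangle=e^{2\pi i j/d}|j\rangle$, $T_{(a_1,a_2)}=\tau^{-a_1a_2}Z^{a_1}X^{a_2}$ with $\tau=e^{(d+1)\pi i/d}$; on composite systems the $T_u$ are tensor products. On a system of dimension $d$ put $A_0=\frac1d\sum_u T_u$, $A_u=T_uA_0T_u^\dagger$, $W_V(u)=\frac1d\operatorname{tr}[A_uV]$ and $\|V\|_{W,1}=\sum_u|W_V(u)|$ for Hermitian $V$. Let $\mathcal W_+$ be the set of states with $W_\rho(u)\ge 0$ for all $u$. A quantum channel $\mathcal F_{A\to B}$ is *CPWP* if $(\mathrm{id}_R\otimes\mathcal F)(\rho)\in\mathcal W_+$ for every (odd-dimensional) $R$ and every $\rho_{RA}\in\mathcal W_+$. A pure state $\psi$ is a *magic state* if $W_\psi(u)<0$ for some $u$. **Divergences.** For a state $\rho$ and $\sigma\ge0$, and $\alpha\in(1,2]$, let $$\widehat D_\alpha(\rho\|\sigma)=\tfrac1{\alpha-1}\log\operatorname{tr}\big[\sigma^{1/2}(\sigma^{-1/2}\rho\,\sigma^{-1/2})^\alpha\sigma^{1/2}\big]$$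 if $\operatorname{supp}\rho\subseteq\operatorname{supp}\sigma$ (inverses on the support), and $+\infty$ otherwise; $D_{\max}(\rho\|\sigma)=\inf\{\log t : \rho\le t\sigma\}$; $D_{\min}(\rho\|\sigma)=-\log\operatorname{tr}[\Pi_\rho\sigma]$ with $\Pi_\rho$ the support projector of $\rho$. For completely positive $\mathcal N,\mathcal E$ from $A$ to $B$, and $\mathbf D\in\{\widehat D_\alpha,D_{\max}\}$, $\mathbf D(\mathcal N\|\mathcal E)$ is the supremum of $\mathbf D\big((\mathrm{id}\otimes\mathcal N)(\phi)\,\|\,(\mathrm{id}\otimes\mathcal E)(\phi)\big)$ over all pure states $\phi$ of $A'A$ with $A'\cong A$. **Thauma.** Let $\mathcal W=\{\sigma\ge0 : \log\|\sigma\|_{W,1}\le0\}$ and let $\mathcal V$ be the set of completely positive maps $\mathcal E_{A\to B}$ with $\log\max_u\|\mathcal E(A_u)\|_{W,1}\le 0$. Put $$\widehat\theta_\alpha(\mathcal N)=\inf_{\mathcal E\in\mathcal V}\widehat D_\alpha(\mathcal N\|\mathcal E),\quad \theta_{\max}(\mathcal N)=\inf_{\mathcal E\in\mathcal V}D_{\max}(\mathcal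 N\|\mathcal E),\quad \theta_{\min}(\psi)=\inf_{\sigma\in\mathcal W}D_{\min}(\psi\|\sigma).$$ **Capacities.** An $(n,k,\varepsilon)$ $\psi$-magic state generation protocol for a channel $\mathcal N_{A\to B}$ starts with a state of $R_1A$ prepared by a CPWP operation from the trivial system, uses $\mathcal N$ (on the system $A$) $n$ times with a CPWP operation $R_iB\to R_{i+1}A$ between consecutive uses, where the memory systems $R_i$ are arbitrary, and ends with a CPWP operation onto $k$ copies of the system of $\psi$, so that the final state $\omega$ satisfies $\operatorname{tr}[\omega\,\psi^{\otimes k}]\ge1-\varepsilon$. A rate $r$ is *achievable* if for all $\varepsilon\in(0,1]$, $\delta>0$ and all sufficiently large $n$ there is an $(n,k,\varepsilon)$ protocol with $k\ge n(r-\delta)$; $C_\psi(\mathcal N)$ is the supremum of the achievable rates. A number $r_0$ is a *strong converse rate* if for every $r>r_0$ the largest fidelity $\operatorname{tr}[\omega\,\psi^{\otimes k}]$ of $n$-round protocols with $k\ge nr$ tends to $0$ as $n\to\infty$; $C^\dagger_\psi(\mathcal N)$ is the infimum of the strong converse rates. All quantities are extended-real-valued. **Theorem.** For every quantum channel $\mathcal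 N$, every $\alpha\in(1,2]$ and every pure magic state $\psi$, one has $0<\theta_{\min}(\psi)<\infty$ and $$C_\psi(\mathcal N)\;\le\; C^\dagger_\psi(\mathcal N)\;\le\;\frac{\widehat\theta_\alpha(\mathcal N)}{\theta_{\min}(\psi)}\;\le\;\frac{\theta_{\max}(\mathcal N)}{\theta_{\min}(\psi)}.$$ -/

import Mathlib

open scoped ENNReal NNReal Matrix Kronecker ComplexOrder

noncomputable section

namespace Magic

/-! ### Odd-dimensional systems

Every system is an iterated tensor product of qudits of odd prime dimension; `unit` is the trivial
one-dimensional system. -/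

/-- Quantum systems: tensor products of qudits of odd prime dimension. -/
inductive QSys : Type
  | unit : QSys
  | qudit (p : ℕ) (hp : p.Prime) (hodd : Odd p) : QSys
  | tensor (A B : QSys) : QSys

namespace QSys

/-- Labels of the computational basis. -/
def Basis : QSys → Type
  | unit => Unit
  | qudit p _ _ => ZMod p
  | tensor A B => A.Basis × B.Basis

/-- Points of the discrete phase space. -/
def Phase : QSys → Type
  | unit => Unit
  | qudit p _ _ => ZMod p × ZMod p
  | tensor A B => A.Phase × B.Phase

@[reducible] def fintypeBasis : (S : QSys) → Fintype S.Basis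
  | unit => inferInstanceAs (Fintype Unit)
  | qudit p hp _ =>
    haveI : NeZero p := ⟨hp.ne_zero⟩
    inferInstanceAs (Fintype (ZMod p))
  | tensor A B =>
    letI := A.fintypeBasis
    letI := B.fintypeBasis
    inferInstanceAs (Fintype (A.Basis × B.Basis))

@[reducible] def decEqBasis : (S : QSys) → DecidableEq S.Basis
  | unit => inferInstanceAs (DecidableEq Unit)
  | qudit p _ _ => inferInstanceAs (DecidableEq (ZMod p))
  | tensor A B =>
    letI := A.decEqBasis
    letI := B.decEqBasis
    inferInstanceAs (DecidableEq (A.Basis × B.Basis))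

@[reducible] def fintypePhase : (S : QSys) → Fintype S.Phase
  | unit => inferInstanceAs (Fintype Unit)
  | qudit p hp _ =>
    haveI : NeZero p := ⟨hp.ne_zero⟩
    inferInstanceAs (Fintype (ZMod p × ZMod p))
  | tensor A B =>
    letI := A.fintypePhase
    letI := B.fintypePhase
    inferInstanceAs (Fintype (A.Phase × B.Phase))

instance (S : QSys) : Fintype S.Basis := S.fintypeBasis
instance (S : QSys) : DecidableEq S.Basis := S.decEqBasis
instance (S : QSys) : Fintype S.Phase := S.fintypePhase

/-- The Hilbert space dimension. -/
def dim (S : QSys) : ℕ := Fintype.card S.Basis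

/-- `k` copies of a system. -/
def pow (S : QSys) : ℕ → QSys
  | 0 => unit
  | k + 1 => tensor (S.pow k) S

/-- The phase-space origin. -/
def origin : (S : QSys) → S.Phase
  | unit => ()
  | qudit _ _ _ => (0, 0)
  | tensor A B => (A.origin, B.origin)

end QSys

/-- Linear operators on a system, as matrices in the computational basis. -/
abbrev Op (S : QSys) : Type := Matrix S.Basis S.Basis ℂ

/-- Linear maps from operators on `A` to operators on `B`. -/
abbrev SuperOp (A B : QSys) : Type := Op A →ₗ[ℂ] Op B

/-! ### Heisenberg-Weyl operators and the discrete Wigner function -/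

/-- The shift `X |j⟩ = |j + 1⟩`. -/
def shiftOp (p : ℕ) : Matrix (ZMod p) (ZMod p) ℂ :=
  Matrix.of fun i j => if i = j + 1 then 1 else 0

/-- The boost `Z |j⟩ = ω ^ j |j⟩` with `ω = exp (2 π i / p)`. -/
def boostOp (p : ℕ) : Matrix (ZMod p) (ZMod p) ℂ :=
  Matrix.diagonal fun j => Complex.exp (2 * Real.pi * Complex.I / p) ^ j.val

/-- `τ = exp ((p + 1) π i / p)`. -/
def tau (p : ℕ) : ℂ := Complex.exp ((p + 1) * Real.pi * Complex.I / p)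

/-- Heisenberg-Weyl operators: `τ ^ (-a₁ a₂) Z ^ a₁ X ^ a₂` on a qudit of prime dimension, and
tensor products of these on composite systems. -/
def heisenbergWeyl : (S : QSys) → S.Phase → Op S
  | .unit, _ => (1 : Matrix Unit Unit ℂ)
  | .qudit p hp _, a =>
    haveI : NeZero p := ⟨hp.ne_zero⟩
    ((tau p) ^ (-((a.1.val * a.2.val : ℕ) : ℤ)) •
      (boostOp p ^ a.1.val * shiftOp p ^ a.2.val) : Matrix (ZMod p) (ZMod p) ℂ)
  | .tensor A B, u => heisenbergWeyl A u.1 ⊗ₖ heisenbergWeyl B u.2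

/-- `A₀ = (1/d) ∑ᵤ Tᵤ`. -/
def phasePointZero (S : QSys) : Op S := ((S.dim : ℂ)⁻¹) • ∑ u : S.Phase, heisenbergWeyl S u

/-- `Aᵤ = Tᵤ A₀ Tᵤ†`. -/
def phasePoint (S : QSys) (u : S.Phase) : Op S :=
  heisenbergWeyl S u * phasePointZero S * (heisenbergWeyl S u)ᴴ

/-- The discrete Wigner function `W_V(u) = (1/d) tr [Aᵤ V]` of a Hermitian operator. -/
def wigner {S : QSys} (V : Op S) (u : S.Phase) : ℝ := ((phasePoint S u * V).trace).re / S.dim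

/-- The Wigner trace norm `∑ᵤ |W_V(u)|`. -/
def wignerTraceNorm {S : QSys} (V : Op S) : ℝ := ∑ u : S.Phase, |wigner V u|

/-! ### States and channels -/

/-- Density operators. -/
def IsState {n : Type} [Fintype n] (ρ : Matrix n n ℂ) : Prop := ρ.PosSemidef ∧ ρ.trace = 1

/-- States with nonnegative Wigner function. -/
def PosWigner (S : QSys) : Set (Op S) := {ρ | IsState ρ ∧ ∀ u, 0 ≤ wigner ρ u}

/-- `(id_r ⊗ N)(X)`. -/
def idTensor {a b : Type} (r : Type) (N : Matrix a a ℂ →ₗ[ℂ] Matrix b b ℂ)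
    (X : Matrix (r × a) (r × a) ℂ) : Matrix (r × b) (r × b) ℂ :=
  Matrix.of fun i j => N (Matrix.of fun x y => X (i.1, x) (j.1, y)) i.2 j.2

/-- `(id_R ⊗ N)(X)` for an operator `X` on the composite system `R A`. -/
def applyRight {A B : QSys} (R : QSys) (N : SuperOp A B) (X : Op (R.tensor A)) :
    Op (R.tensor B) := idTensor R.Basis N X

/-- Complete positivity. -/
def IsCP {A B : QSys} (N : SuperOp A B) : Prop :=
  ∀ (m : ℕ) (X : Matrix (Fin m × A.Basis) (Fin m × A.Basis) ℂ),
    X.PosSemidef → (idTensor (Fin m) N X).PosSemidef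

/-- Quantum channels (quantum operations): completely positive trace-preserving maps. -/
def IsChannel {A B : QSys} (N : SuperOp A B) : Prop :=
  IsCP N ∧ ∀ X, (N X).trace = X.trace

/-- Completely positive Wigner preserving operations. -/
def IsCPWP {A B : QSys} (F : SuperOp A B) : Prop :=
  IsChannel F ∧ ∀ (R : QSys), ∀ ρ ∈ PosWigner (R.tensor A), applyRight R F ρ ∈ PosWigner (R.tensor B)

/-! ### Divergences, with values in the extended reals -/

/-- The base-two logarithm, with `log 0 = -∞` and `log ∞ = ∞`. -/
def log2 (x : ℝ≥0∞) : EReal := ENNReal.log x / ((Real.log 2 : ℝ) : EReal)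

/-- Two-argument functionals of positive semidefinite matrices of any finite size. -/
abbrev Divergence : Type 1 :=
  (n : Type) → [Fintype n] → [DecidableEq n] → Matrix n n ℂ → Matrix n n ℂ → EReal

/-- `ρ ^ s` for positive semidefinite `ρ`; for `s ≠ 0` the power is taken on the support of `ρ`,
because `(0 : ℝ) ^ s = 0`. -/
def matPow {n : Type} [Fintype n] [DecidableEq n] (ρ : Matrix n n ℂ) (s : ℝ) : Matrix n n ℂ :=
  cfc (fun x : ℝ => x ^ s) ρ

/-- The projector onto the support of a Hermitian matrix. -/
def suppProj {n : Type} [Fintype n] [DecidableEq n] (ρ : Matrix n n ℂ) : Matrix n n ℂ :=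
  cfc (fun x : ℝ => if x = 0 then 0 else 1) ρ

/-- `supp ρ ⊆ supp σ` for Hermitian matrices, written as `ker σ ⊆ ker ρ`. -/
def SuppLE {n : Type} [Fintype n] (ρ σ : Matrix n n ℂ) : Prop :=
  ∀ v : n → ℂ, σ *ᵥ v = 0 → ρ *ᵥ v = 0

open Classical in
/-- The geometric Rényi divergence
`(1/(α-1)) log tr [σ^{1/2} (σ^{-1/2} ρ σ^{-1/2})^α σ^{1/2}]` if `supp ρ ⊆ supp σ`,
and `+∞` otherwise. -/
def geoDiv (α : ℝ) : Divergence := fun _ _ _ ρ σ =>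
  if SuppLE ρ σ then
    (((α - 1)⁻¹ : ℝ) : EReal) * log2 (ENNReal.ofReal
      (matPow σ (1 / 2) * matPow (matPow σ (-1 / 2) * ρ * matPow σ (-1 / 2)) α *
        matPow σ (1 / 2)).trace.re)
  else ⊤

/-- The max-relative entropy `min {log t | ρ ≤ t σ}`. -/
def maxDiv : Divergence := fun _ _ _ ρ σ =>
  ⨅ (t : ℝ≥0) (_ : ((t : ℝ) • σ - ρ).PosSemidef), log2 (t : ℝ≥0∞)

/-- The min-relative entropy `- log tr [Π_ρ σ]`. -/
def minDiv : Divergence := fun _ _ _ ρ σ => -log2 (ENNReal.ofReal (suppProj ρ * σ).trace.re)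

/-- The rank-one operator `|φ⟩⟨φ|`. -/
def proj {n : Type} (φ : n → ℂ) : Matrix n n ℂ := Matrix.vecMulVec φ (star φ)

/-- The channel divergence induced by `D`: the supremum over all pure states `φ` of a copy of `A`
and `A` (these are exactly the purifications of the states of the copy) of the divergence
of the two outputs. -/
def channelDiv (D : Divergence) {A B : QSys} (N M : SuperOp A B) : EReal :=
  ⨆ (φ : (A.tensor A).Basis → ℂ) (_ : star φ ⬝ᵥ φ = 1),
    D (A.tensor B).Basis (applyRight A N (proj φ)) (applyRight A M (proj φ))

/-! ### Mana and Thauma -/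

/-- The mana of a positive semidefinite operator. -/
def mana {S : QSys} (σ : Op S) : EReal := log2 (ENNReal.ofReal (wignerTraceNorm σ))

/-- The mana of a completely positive map. -/
def channelMana {A B : QSys} (E : SuperOp A B) : EReal :=
  log2 (⨆ u : A.Phase, ENNReal.ofReal (wignerTraceNorm (E (phasePoint A u))))

/-- The positive semidefinite operators of non-positive mana. -/
def manaFree (S : QSys) : Set (Op S) := {σ | σ.PosSemidef ∧ mana σ ≤ 0}

/-- The completely positive maps of non-positive mana. -/
def channelManaFree (A B : QSys) : Set (SuperOp A B) := {E | IsCP E ∧ channelMana E ≤ 0}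

/-- The Thauma of a state induced by a divergence. -/
def thauma (D : Divergence) {S : QSys} (ρ : Op S) : EReal := ⨅ σ ∈ manaFree S, D S.Basis ρ σ

/-- The Thauma of a channel induced by a divergence. -/
def channelThauma (D : Divergence) {A B : QSys} (N : SuperOp A B) : EReal :=
  ⨅ E ∈ channelManaFree A B, channelDiv D N E

/-- Geometric Rényi Thauma of a channel. -/
def geoThauma (α : ℝ) {A B : QSys} (N : SuperOp A B) : EReal := channelThauma (geoDiv α) N

/-- Max-Thauma of a channel. -/
def maxThauma {A B : QSys} (N : SuperOp A B) : EReal := channelThauma maxDiv N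

/-- Min-Thauma of a state. -/
def minThauma {S : QSys} (ρ : Op S) : EReal := thauma minDiv ρ

/-! ### Magic state generation -/

/-- `|ψ⟩` is a pure magic state: a unit vector whose Wigner function is negative somewhere. -/
def IsMagic {S : QSys} (ψ : S.Basis → ℂ) : Prop :=
  star ψ ⬝ᵥ ψ = 1 ∧ ∃ u, wigner (proj ψ) u < 0

/-- The vector `|ψ⟩^{⊗ k}`. -/
def copies {S : QSys} (ψ : S.Basis → ℂ) : (k : ℕ) → (S.pow k).Basis → ℂ
  | 0 => fun _ => 1
  | k + 1 => fun x => copies ψ k x.1 * ψ x.2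

/-- `Generates N n X ω`: some protocol that uses `N` exactly `n` times, with a CPWP operation
before the first use, between consecutive uses (acting on the memory system `R` and the output of
`N`), and after the last use, ends with the system `X` in the state `ω`. -/
inductive Generates {A B : QSys} (N : SuperOp A B) : ℕ → (X : QSys) → Op X → Prop
  | start (X : QSys) (F : SuperOp QSys.unit X) (hF : IsCPWP F) : Generates N 0 X (F 1)
  | round {n : ℕ} {R : QSys} {ρ : Op (R.tensor A)} (h : Generates N n (R.tensor A) ρ)
      (Y : QSys) (F : SuperOp (R.tensor B) Y) (hF : IsCPWP F) :
      Generates N (n + 1) Y (F (applyRight R N ρ))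

/-- The fidelity `tr [ω |ψ⟩⟨ψ|^{⊗ k}]`. -/
def fidelity {S : QSys} (ψ : S.Basis → ℂ) (k : ℕ) (ω : Op (S.pow k)) : ℝ :=
  ((ω * proj (copies ψ k)).trace).re

/-- There is an `(n, k, ε)` `ψ`-magic state generation protocol. -/
def HasProtocol {A B S : QSys} (N : SuperOp A B) (ψ : S.Basis → ℂ) (n k : ℕ) (ε : ℝ) : Prop :=
  ∃ ω : Op (S.pow k), Generates N n (S.pow k) ω ∧ 1 - ε ≤ fidelity ψ k ω

/-- Achievable rates: for all `ε ∈ (0, 1]` and `δ > 0`, for all large `n` at least `n (r - δ)`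
copies can be generated with error at most `ε`. -/
def Achievable {A B S : QSys} (N : SuperOp A B) (ψ : S.Basis → ℂ) (r : ℝ) : Prop :=
  ∀ ε : ℝ, 0 < ε → ε ≤ 1 → ∀ δ : ℝ, 0 < δ → ∃ n₀ : ℕ, ∀ n ≥ n₀, ∃ k : ℕ,
    (n : ℝ) * (r - δ) ≤ k ∧ HasProtocol N ψ n k ε

/-- Strong converse rates: for every `r > r₀`, the fidelity of protocols that generate at least
`n r` copies tends to zero as the number `n` of rounds grows. -/
def StrongConverse {A B S : QSys} (N : SuperOp A B) (ψ : S.Basis → ℂ) (r₀ : ℝ) : Prop :=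
  ∀ r : ℝ, r₀ < r → ∀ η : ℝ, 0 < η → ∃ n₀ : ℕ, ∀ n ≥ n₀, ∀ k : ℕ, (n : ℝ) * r ≤ k →
    ∀ ω : Op (S.pow k), Generates N n (S.pow k) ω → fidelity ψ k ω ≤ η

/-- The `ψ`-magic state generation capacity. -/
def capacity {A B S : QSys} (N : SuperOp A B) (ψ : S.Basis → ℂ) : EReal :=
  sSup {x : EReal | ∃ r : ℝ, x = r ∧ Achievable N ψ r}

/-- The strong converse `ψ`-magic state generation capacity. -/
def strongCapacity {A B S : QSys} (N : SuperOp A B) (ψ : S.Basis → ℂ) : EReal :=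
  sInf {x : EReal | ∃ r : ℝ, x = r ∧ StrongConverse N ψ r}

end Magic

end

noncomputable section

namespace Magic

set_option linter.unusedSectionVars false

/-! The engine is a reformulation of the geometric Rényi divergence by reverse tests: `ρ = ∑ rᵢ τᵢ`
and `σ = ∑ τᵢ` with `rᵢ ≥ 0`, `τᵢ ≥ 0`, at cost `∑ rᵢ ^ α tr τᵢ`. Diagonalizing `σ^{-1/2} ρ
σ^{-1/2}` gives a test whose cost is the trace in the divergence (`exists_geometric_decomposition`).
In this form data processing is immediate: apply the map to each `τᵢ` (`RevTest.map`). The chain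
rule for channels is almost as direct (`RevTest.chain`): a bound on all pure inputs is applied to
each `τᵢ` separately, so costs multiply even for adaptive protocols with memory.

Fix `E` of non-positive mana whose geometric divergence from `N` is at most `c`, and replace `N` by
`E` in every round. CPWP operations and `id ⊗ E` do not increase the Wigner trace norm, because they
send phase-point operators to operators of norm at most one. The true output `ω` is thus compared
with a mana-free `σ` at cost `2 ^ (n (α - 1) c)` (`Generates.exists_revTest`). Hölder's inequality
(`RevTest.trace_mul_le`) bounds the fidelity by `tr[σ ψ^{⊗k}] ^ (1 - 1/α)` times the `1/α`-th power
of the cost.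

The overlap `tr[σ ψ^{⊗k}]` is at most `2 ^ (-k θ)` for real `θ ≤ θ_min(ψ)`: convex duality turns the
one-copy bound into an operator dominating `ψ`, and such witnesses tensorize
(`re_trace_mul_proj_copies_le`). For `k ≥ n r` the fidelity is then at most `2 ^ (n (1 - 1/α) (c - θ
r))`, which decays once `r > c / θ`.

Positivity of `θ_min` comes from compactness, since a mana-free operator with overlap one would
equal `ψ`, whose Wigner trace norm exceeds one. The comparison with `θ_max` holds because `ρ ≤ t σ`
forces `rⱼ ≤ t`, so that `rⱼ ^ α ≤ t ^ (α - 1) rⱼ`. -/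

/-! ### Phase-point frames -/

/-- The phase-point operators generated by a family of displacement operators. -/
def displaced {n P : Type} [Fintype n] [Fintype P] (T : P → Matrix n n ℂ) (u : P) :
    Matrix n n ℂ :=
  T u * ((Fintype.card n : ℂ)⁻¹ • ∑ v, T v) * (T u)ᴴ

/-- Pointwise Kronecker product of two operator families. -/
def kronFamily {m n P Q : Type} (T : P → Matrix m m ℂ) (U : Q → Matrix n n ℂ) (u : P × Q) :
    Matrix (m × n) (m × n) ℂ :=
  T u.1 ⊗ₖ U u.2

/-- The properties of phase-point operators on which the discrete Wigner formalism rests. -/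
structure IsPhaseFrame {n P : Type} [Fintype n] [DecidableEq n] [Fintype P]
    (A : P → Matrix n n ℂ) : Prop where
  card_pos : 0 < Fintype.card n
  isHermitian : ∀ u, (A u).IsHermitian
  -- Closure under transposition is what makes the maximally entangled state Wigner-positive.
  exists_transpose : ∀ u, ∃ v, (A u)ᵀ = A v
  trace_eq_one : ∀ u, (A u).trace = 1
  -- A disjunction instead of an `if`, so that no decidable equality on `P` is needed.
  trace_mul : ∀ u v, u = v ∧ (A u * A v).trace = Fintype.card n ∨
    u ≠ v ∧ (A u * A v).trace = 0
  -- Completeness: `∑ᵤ Aᵤ ⊗ Aᵤ` is `d` times the swap operator.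
  sum_mul : ∀ i j k l, ∑ u, A u i j * A u k l =
    (Fintype.card n : ℂ) * ((if i = l then 1 else 0) * if j = k then 1 else 0)

lemma displaced_kronFamily {m n P Q : Type} [Fintype m] [Fintype n] [Fintype P] [Fintype Q]
    (T : P → Matrix m m ℂ) (U : Q → Matrix n n ℂ) :
    displaced (kronFamily T U) = kronFamily (displaced T) (displaced U) := by
  funext u
  have h : ((Fintype.card (m × n) : ℂ)⁻¹ • ∑ v, kronFamily T U v) =
      ((Fintype.card m : ℂ)⁻¹ • ∑ v, T v) ⊗ₖ ((Fintype.card n : ℂ)⁻¹ • ∑ v, U v) := by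
    ext i j
    simp only [Matrix.smul_apply, Matrix.sum_apply, Matrix.kroneckerMap_apply, kronFamily,
      Fintype.card_prod, smul_eq_mul]
    rw [Fintype.sum_prod_type, mul_mul_mul_comm, Finset.sum_mul_sum]
    push_cast
    rw [mul_inv]
  rw [displaced, h, kronFamily, Matrix.conjTranspose_kronecker, ← Matrix.mul_kronecker_mul,
    ← Matrix.mul_kronecker_mul]
  rfl

lemma IsPhaseFrame.kron {m n P Q : Type} [Fintype m] [Fintype n] [Fintype P] [Fintype Q]
    [DecidableEq m] [DecidableEq n] {A : P → Matrix m m ℂ} {B : Q → Matrix n n ℂ}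
    (hA : IsPhaseFrame A) (hB : IsPhaseFrame B) : IsPhaseFrame (kronFamily A B) where
  card_pos := by
    rw [Fintype.card_prod]
    exact Nat.mul_pos hA.card_pos hB.card_pos
  isHermitian u := by
    rw [Matrix.IsHermitian, kronFamily, Matrix.conjTranspose_kronecker,
      (hA.isHermitian _).eq, (hB.isHermitian _).eq]
  exists_transpose u := by
    obtain ⟨v, hv⟩ := hA.exists_transpose u.1
    obtain ⟨w, hw⟩ := hB.exists_transpose u.2
    refine ⟨(v, w), ?_⟩
    rw [kronFamily, kronFamily, ← hv, ← hw]
    rfl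
  trace_eq_one u := by
    rw [kronFamily, Matrix.trace_kronecker, hA.trace_eq_one, hB.trace_eq_one, one_mul]
  trace_mul u v := by
    rw [kronFamily, kronFamily, ← Matrix.mul_kronecker_mul, Matrix.trace_kronecker]
    rcases hA.trace_mul u.1 v.1 with ⟨h1, h2⟩ | ⟨h1, h2⟩
    · rcases hB.trace_mul u.2 v.2 with ⟨h3, h4⟩ | ⟨h3, h4⟩
      · left
        refine ⟨Prod.ext h1 h3, ?_⟩
        rw [h2, h4, Fintype.card_prod]
        push_cast
        rfl
      · right
        exact ⟨fun h => h3 (congrArg Prod.snd h), by rw [h4, mul_zero]⟩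
    · right
      exact ⟨fun h => h1 (congrArg Prod.fst h), by rw [h2, zero_mul]⟩
  sum_mul i j k l := by
    simp only [kronFamily, Matrix.kroneckerMap_apply, Fintype.sum_prod_type]
    simp only [mul_mul_mul_comm (A _ _ _) (B _ _ _)]
    rw [← Finset.sum_mul_sum, hA.sum_mul, hB.sum_mul, Fintype.card_prod]
    simp only [Prod.ext_iff, ite_and]
    push_cast
    split_ifs <;> simp

/-! ### Phase-point operators of a single qudit -/

section Qudit

variable {p : ℕ} [NeZero p]

/-- The inverse of two modulo an odd number. -/
def halfMod (p : ℕ) : ZMod p := ((p + 1) / 2 : ℕ)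

lemma two_mul_halfMod (hodd : Odd p) : 2 * halfMod p = 1 := by
  obtain ⟨m, rfl⟩ := hodd
  have h : (2 * m + 1 + 1) / 2 = m + 1 := by omega
  have h0 : ((2 * m + 1 : ℕ) : ZMod (2 * m + 1)) = 0 := ZMod.natCast_self _
  rw [halfMod, h]
  push_cast at h0 ⊢
  linear_combination h0

lemma stdAddChar_natCast (n : ℕ) :
    ZMod.stdAddChar (n : ZMod p) = Complex.exp (2 * Real.pi * Complex.I / p) ^ n := by
  have := ZMod.stdAddChar_coe (N := p) (n : ℤ)
  rw [Int.cast_natCast] at this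
  rw [this, ← Complex.exp_nat_mul]
  congr 1
  push_cast
  ring

/-- `τ` is `ω ^ (1/2)` with the half taken modulo `p`, so every phase below is a value of one
additive character and phase identities become ring identities in `ZMod p`. -/
lemma tau_eq (hodd : Odd p) : tau p = ZMod.stdAddChar (halfMod p) := by
  rw [halfMod, stdAddChar_natCast, tau, ← Complex.exp_nat_mul]
  congr 1
  obtain ⟨m, rfl⟩ := hodd
  have h : (2 * m + 1 + 1) / 2 = m + 1 := by omega
  rw [h]
  push_cast
  ring

lemma boostOp_pow_apply (n : ℕ) (i j : ZMod p) :
    (boostOp p ^ n) i j = if i = j then ZMod.stdAddChar ((n : ZMod p) * i) else 0 := by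
  rw [boostOp, Matrix.diagonal_pow, Matrix.diagonal_apply]
  refine if_congr Iff.rfl ?_ rfl
  rw [Pi.pow_apply, ← stdAddChar_natCast, ZMod.natCast_zmod_val, ← AddChar.map_nsmul_eq_pow,
    nsmul_eq_mul]

lemma shiftOp_pow_apply (n : ℕ) (i j : ZMod p) :
    (shiftOp p ^ n) i j = if i = j + n then 1 else 0 := by
  induction n generalizing i with
  | zero => simp [Matrix.one_apply]
  | succ n ih =>
    rw [pow_succ', Matrix.mul_apply, Finset.sum_eq_single (i - 1)]
    · rw [ih]
      have : (i - 1 = j + n) ↔ i = j + ((n + 1 : ℕ) : ZMod p) := by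
        push_cast
        constructor <;> intro h <;> linear_combination h
      simp [shiftOp, this]
    · intro k _ hk
      have : i ≠ k + 1 := fun h => hk (by rw [h]; ring)
      simp [shiftOp, this]
    · simp

/-- The Heisenberg-Weyl operator of a qudit. -/
def quditHW (p : ℕ) [NeZero p] (a : ZMod p × ZMod p) : Matrix (ZMod p) (ZMod p) ℂ :=
  (tau p) ^ (-((a.1.val * a.2.val : ℕ) : ℤ)) • (boostOp p ^ a.1.val * shiftOp p ^ a.2.val)

lemma quditHW_apply (hodd : Odd p) (a : ZMod p × ZMod p) (i j : ZMod p) :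
    quditHW p a i j =
      if i = j + a.2 then ZMod.stdAddChar (a.1 * i - a.1 * a.2 * halfMod p) else 0 := by
  have ht : tau p ^ (-((a.1.val * a.2.val : ℕ) : ℤ)) =
      ZMod.stdAddChar (-(a.1 * a.2 * halfMod p)) := by
    rw [tau_eq hodd, ← AddChar.map_zsmul_eq_zpow]
    congr 1
    rw [zsmul_eq_mul]
    push_cast
    simp
  rw [quditHW, Matrix.smul_apply, Matrix.mul_apply, Finset.sum_eq_single i, boostOp_pow_apply,
    shiftOp_pow_apply, ht]
  · simp only [ZMod.natCast_zmod_val, if_true, smul_eq_mul]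
    split_ifs
    · rw [mul_one, ← AddChar.map_add_eq_mul]
      congr 1
      ring
    · simp
  · intro k _ hk
    rw [boostOp_pow_apply, if_neg (Ne.symm hk), zero_mul]
  · simp

lemma sum_stdAddChar_mul (b : ZMod p) :
    ∑ x : ZMod p, (ZMod.stdAddChar (x * b) : ℂ) = if b = 0 then (p : ℂ) else 0 := by
  rw [AddChar.sum_mulShift b (ZMod.isPrimitive_stdAddChar p), ZMod.card]
  simp

/-- The displacement operators sum to `p` times the parity operator `|j⟩ ↦ |-j⟩`: the position shift
is fixed by the entry, and summing over the boost forces `i + j = 0`. -/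
lemma sum_quditHW_apply (hodd : Odd p) (i j : ZMod p) :
    (∑ a : ZMod p × ZMod p, quditHW p a) i j = if i + j = 0 then (p : ℂ) else 0 := by
  rw [Matrix.sum_apply, Fintype.sum_prod_type]
  simp only [quditHW_apply hodd]
  have h2 := two_mul_halfMod hodd
  have : ∀ x : ZMod p, (∑ y : ZMod p, if i = j + y then
      (ZMod.stdAddChar (x * i - x * y * halfMod p) : ℂ) else 0) =
      ZMod.stdAddChar (x * ((i + j) * halfMod p)) := by
    intro x
    rw [Finset.sum_eq_single (i - j)]
    · rw [if_pos (by ring)]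
      congr 1
      linear_combination (-x * i) * h2
    · intro y _ hy
      exact if_neg fun h => hy (by rw [h]; ring)
    · simp
  simp only [this, sum_stdAddChar_mul]
  refine if_congr ?_ rfl rfl
  constructor
  · intro h
    linear_combination 2 * h - (i + j) * h2
  · intro h
    rw [h, zero_mul]

lemma star_stdAddChar (x : ZMod p) :
    star (ZMod.stdAddChar x : ℂ) = ZMod.stdAddChar (-x) := by
  rw [AddChar.map_neg_eq_conj]
  rfl

/-- Parity conjugated by a displacement is reflection about `a.2` with a phase. All frame properties
are read off from this formula by orthogonality of characters and invertibility of two. -/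
lemma displaced_quditHW_apply (hodd : Odd p) (a : ZMod p × ZMod p) (i j : ZMod p) :
    displaced (quditHW p) a i j =
      if i + j = 2 * a.2 then ZMod.stdAddChar (a.1 * (i - j)) else 0 := by
  rw [displaced, ZMod.card]
  have hp : (p : ℂ) ≠ 0 := Nat.cast_ne_zero.2 (NeZero.ne p)
  rw [Matrix.mul_apply, Finset.sum_eq_single (j - a.2), Matrix.mul_apply,
    Finset.sum_eq_single (i - a.2)]
  · rw [Matrix.smul_apply, sum_quditHW_apply hodd, Matrix.conjTranspose_apply,
      quditHW_apply hodd, quditHW_apply hodd, if_pos (show i = i - a.2 + a.2 by ring),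
      if_pos (show j = j - a.2 + a.2 by ring),
      star_stdAddChar]
    have : (i - a.2 + (j - a.2) = 0) ↔ i + j = 2 * a.2 := by
      constructor <;> intro h <;> linear_combination h
    simp only [this]
    split_ifs
    · rw [smul_eq_mul, inv_mul_cancel₀ hp, mul_one, ← AddChar.map_add_eq_mul]
      congr 1
      ring
    · simp
  · intro k _ hk
    rw [quditHW_apply hodd, if_neg fun h => hk (by rw [h]; ring), zero_mul]
  · simp
  · intro k _ hk
    rw [Matrix.conjTranspose_apply, quditHW_apply hodd, if_neg fun h => hk (by rw [h]; ring),
      star_zero, mul_zero]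
  · simp

lemma isPhaseFrame_qudit (hodd : Odd p) : IsPhaseFrame (displaced (quditHW p)) where
  card_pos := Fintype.card_pos
  isHermitian a := by
    refine Matrix.IsHermitian.ext fun i j => ?_
    rw [displaced_quditHW_apply hodd, displaced_quditHW_apply hodd, apply_ite star, star_zero,
      star_stdAddChar, add_comm]
    congr 2
    ring
  exists_transpose a := by
    -- Transposition reverses momentum and keeps position.
    refine ⟨(-a.1, a.2), ?_⟩
    ext i j
    rw [Matrix.transpose_apply, displaced_quditHW_apply hodd, displaced_quditHW_apply hodd,
      add_comm]
    congr 2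
    ring
  trace_eq_one a := by
    have h2 := two_mul_halfMod hodd
    rw [Matrix.trace, Finset.sum_eq_single a.2]
    · rw [Matrix.diag_apply, displaced_quditHW_apply hodd, if_pos (two_mul _).symm]
      simp
    · intro i _ hi
      rw [Matrix.diag_apply, displaced_quditHW_apply hodd, if_neg]
      intro h
      exact hi (by linear_combination halfMod p * h - (i - a.2) * h2)
    · simp
  trace_mul a b := by
    have h2 := two_mul_halfMod hodd
    have hdiag (i : ZMod p) : (displaced (quditHW p) a * displaced (quditHW p) b) i i =
        if a.2 = b.2 then
          ZMod.stdAddChar (i * (2 * (a.1 - b.1))) *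
            ZMod.stdAddChar (-(2 * a.2 * (a.1 - b.1))) else 0 := by
      rw [Matrix.mul_apply, Finset.sum_eq_single (2 * a.2 - i), displaced_quditHW_apply hodd,
        displaced_quditHW_apply hodd, if_pos (by ring)]
      · have : (2 * a.2 - i + i = 2 * b.2) ↔ a.2 = b.2 := by
          constructor
          · intro h
            linear_combination halfMod p * h - (a.2 - b.2) * h2
          · intro h
            linear_combination 2 * h
        simp only [this, mul_ite, mul_zero, ← AddChar.map_add_eq_mul]
        refine if_congr Iff.rfl ?_ rfl
        congr 1
        ring
      · intro j _ hj
        rw [displaced_quditHW_apply hodd, if_neg, zero_mul]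
        intro h
        exact hj (by linear_combination h)
      · simp
    by_cases h : a.2 = b.2
    · simp only [Matrix.trace, Matrix.diag_apply, hdiag, if_pos h]
      rw [← Finset.sum_mul, sum_stdAddChar_mul]
      by_cases h' : a.1 = b.1
      · left
        refine ⟨Prod.ext h' h, ?_⟩
        rw [h']
        simp
      · right
        refine ⟨fun e => h' (congrArg Prod.fst e), ?_⟩
        rw [if_neg, zero_mul]
        intro e
        exact h' (by linear_combination halfMod p * e - (a.1 - b.1) * h2)
    · right
      refine ⟨fun e => h (congrArg Prod.snd e), ?_⟩
      simp only [Matrix.trace, Matrix.diag_apply, hdiag, if_neg h, Finset.sum_const_zero]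
  sum_mul i j k l := by
    have h2 := two_mul_halfMod hodd
    have hsum (y : ZMod p) : ∑ x : ZMod p,
        displaced (quditHW p) (x, y) i j * displaced (quditHW p) (x, y) k l =
        if i + j = 2 * y then if i = l ∧ j = k then (p : ℂ) else 0 else 0 := by
      simp only [displaced_quditHW_apply hodd]
      by_cases hy : i + j = 2 * y
      · simp only [if_pos hy]
        by_cases hy' : k + l = 2 * y
        · simp only [if_pos hy', ← AddChar.map_add_eq_mul, ← mul_add, sum_stdAddChar_mul]
          refine if_congr ?_ rfl rfl
          constructor
          · intro h
            constructor
            · linear_combination halfMod p * (h + hy - hy') - (i - l) * h2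
            · linear_combination halfMod p * (-h + hy - hy') - (j - k) * h2
          · rintro ⟨rfl, rfl⟩
            ring
        · rw [if_neg]
          · simp [if_neg hy']
          · rintro ⟨rfl, rfl⟩
            exact hy' (by rw [← hy, add_comm])
      · simp [if_neg hy]
    rw [Fintype.sum_prod_type_right, ZMod.card]
    simp only [hsum]
    rw [Finset.sum_eq_single (halfMod p * (i + j)),
      if_pos (by linear_combination -(i + j) * h2), ite_and]
    · split_ifs <;> simp
    · intro y _ hy
      rw [if_neg]
      intro h
      exact hy (by linear_combination -halfMod p * h - y * h2)
    · simp

end Qudit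

lemma phasePoint_tensor (S T : QSys) :
    (phasePoint (S.tensor T) : S.Phase × T.Phase → Matrix (S.Basis × T.Basis) _ ℂ) =
      kronFamily (phasePoint S) (phasePoint T) :=
  displaced_kronFamily (heisenbergWeyl S) (heisenbergWeyl T)

lemma isPhaseFrame_phasePoint (S : QSys) : IsPhaseFrame (phasePoint S) := by
  induction S with
  | unit =>
    have h : displaced (fun _ : Unit => (1 : Matrix Unit Unit ℂ)) = fun _ => 1 := by
      funext u
      simp [displaced]
    have : IsPhaseFrame (displaced (fun _ : Unit => (1 : Matrix Unit Unit ℂ))) := by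
      rw [h]
      exact ⟨by simp, fun u => by simp, fun u => ⟨u, by simp⟩, by simp,
        fun u v => Or.inl ⟨rfl, by simp⟩, by simp⟩
    exact this
  | qudit p hp hodd =>
    have : NeZero p := ⟨hp.ne_zero⟩
    exact isPhaseFrame_qudit hodd
  | tensor S T hS hT =>
    have h := hS.kron hT
    rw [← phasePoint_tensor] at h
    exact h

/-! ### The Wigner function of a phase-point frame -/

/-- The Wigner function of `V` with respect to the phase-point operators `A`. -/
def frameWigner {n P : Type} [Fintype n] (A : P → Matrix n n ℂ) (V : Matrix n n ℂ) (u : P) : ℝ :=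
  ((A u * V).trace).re / Fintype.card n

/-- The Wigner trace norm of `V` with respect to the phase-point operators `A`. -/
def frameNorm {n P : Type} [Fintype n] [Fintype P] (A : P → Matrix n n ℂ) (V : Matrix n n ℂ) : ℝ :=
  ∑ u, |frameWigner A V u|

lemma wigner_eq_frameWigner {S : QSys} (V : Op S) : wigner V = frameWigner (phasePoint S) V := rfl

lemma wignerTraceNorm_eq_frameNorm {S : QSys} (V : Op S) :
    wignerTraceNorm V = frameNorm (phasePoint S) V := rfl

section Frame

variable {n P m Q r T : Type} [Fintype n] [DecidableEq n] [Fintype P] [Fintype m] [DecidableEq m]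
  [Fintype Q] [Fintype r] [DecidableEq r] [Fintype T]
  {A : P → Matrix n n ℂ} {B : Q → Matrix m m ℂ} {C : T → Matrix r r ℂ}

lemma frameWigner_sum_smul {ι : Type} (s : Finset ι) (c : ι → ℝ) (V : ι → Matrix n n ℂ) (u : P) :
    frameWigner A (∑ i ∈ s, (c i : ℂ) • V i) u = ∑ i ∈ s, c i * frameWigner A (V i) u := by
  simp only [frameWigner, Matrix.mul_sum, Matrix.trace_sum, Complex.re_sum, Finset.sum_div,
    Matrix.mul_smul, Matrix.trace_smul, smul_eq_mul, Complex.re_ofReal_mul, mul_div_assoc]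

lemma frameNorm_smul {c : ℝ} (hc : 0 ≤ c) (V : Matrix n n ℂ) :
    frameNorm A ((c : ℂ) • V) = c * frameNorm A V := by
  have h (u : P) : frameWigner A ((c : ℂ) • V) u = c * frameWigner A V u := by
    simpa using frameWigner_sum_smul (A := A) (Finset.univ : Finset Unit) (fun _ => c)
      (fun _ => V) u
  simp only [frameNorm, h, abs_mul, abs_of_nonneg hc, Finset.mul_sum]

lemma IsPhaseFrame.card_ne_zero (hA : IsPhaseFrame A) : (Fintype.card n : ℂ) ≠ 0 :=
  Nat.cast_ne_zero.2 hA.card_pos.ne'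

/-- Completeness of the frame contracted with `V`; this lets an operator be recovered from its
Wigner function. -/
lemma IsPhaseFrame.expansion (hA : IsPhaseFrame A) (V : Matrix n n ℂ) :
    (Fintype.card n : ℂ) • V = ∑ u, (A u * V).trace • A u := by
  ext i j
  have h : ∀ u, ((A u * V).trace • A u) i j = ∑ k, ∑ l, (A u k l * A u i j) * V l k := by
    intro u
    simp only [Matrix.smul_apply, Matrix.trace, Matrix.diag_apply, Matrix.mul_apply, smul_eq_mul,
      Finset.sum_mul]
    refine Finset.sum_congr rfl fun k _ => Finset.sum_congr rfl fun l _ => ?_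
    ring
  rw [Matrix.sum_apply]
  simp only [h]
  rw [Finset.sum_comm]
  have h' : ∀ k, ∑ u, ∑ l, (A u k l * A u i j) * V l k =
      ∑ l, (Fintype.card n : ℂ) * ((if k = j then 1 else 0) * if l = i then 1 else 0) * V l k := by
    intro k
    rw [Finset.sum_comm]
    refine Finset.sum_congr rfl fun l _ => ?_
    rw [← Finset.sum_mul, hA.sum_mul]
  simp only [h']
  simp

lemma trace_mul_im_eq_zero {X Y : Matrix n n ℂ} (hX : X.IsHermitian) (hY : Y.IsHermitian) :
    ((X * Y).trace).im = 0 := by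
  have h : star (X * Y).trace = (X * Y).trace := by
    rw [← Matrix.trace_conjTranspose, Matrix.conjTranspose_mul, hX.eq, hY.eq, Matrix.trace_mul_comm]
  exact Complex.conj_eq_iff_im.1 h

lemma IsPhaseFrame.expansion_of_isHermitian (hA : IsPhaseFrame A) {V : Matrix n n ℂ}
    (hV : V.IsHermitian) : V = ∑ u, (frameWigner A V u : ℂ) • A u := by
  have h := hA.expansion V
  have h' : ∀ u, (A u * V).trace • A u =
      (Fintype.card n : ℂ) • (frameWigner A V u : ℂ) • A u := by
    intro u
    rw [smul_smul]
    congr 1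
    have := trace_mul_im_eq_zero (hA.isHermitian u) hV
    rw [frameWigner]
    push_cast
    rw [mul_div_cancel₀ _ hA.card_ne_zero]
    exact Complex.ext rfl this
  simp only [h', ← Finset.smul_sum] at h
  exact smul_right_injective _ hA.card_ne_zero h

lemma IsPhaseFrame.sum_apply (hA : IsPhaseFrame A) (i j : n) :
    ∑ u, A u i j = (Fintype.card n : ℂ) * if i = j then 1 else 0 := by
  have h : ∑ u, A u i j = ∑ u, ∑ k, A u i j * A u k k := by
    refine Finset.sum_congr rfl fun u _ => ?_
    rw [← Finset.mul_sum]
    have := hA.trace_eq_one u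
    simp only [Matrix.trace, Matrix.diag_apply] at this
    rw [this, mul_one]
  rw [h, Finset.sum_comm]
  simp only [hA.sum_mul]
  simp

lemma IsPhaseFrame.sum_frameWigner (hA : IsPhaseFrame A) (V : Matrix n n ℂ) :
    ∑ u, frameWigner A V u = V.trace.re := by
  have hs : ∑ u, A u = (Fintype.card n : ℂ) • 1 := by
    ext i j
    rw [Matrix.sum_apply, hA.sum_apply, Matrix.smul_apply, Matrix.one_apply, smul_eq_mul]
  have hd : (Fintype.card n : ℝ) ≠ 0 := Nat.cast_ne_zero.2 hA.card_pos.ne'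
  simp only [frameWigner]
  rw [← Finset.sum_div, ← Complex.re_sum, ← Matrix.trace_sum, ← Finset.sum_mul, hs]
  simp only [Matrix.smul_mul, one_mul, Matrix.trace_smul, smul_eq_mul]
  rw [← Complex.ofReal_natCast, Complex.re_ofReal_mul, mul_div_cancel_left₀ _ hd]

lemma IsPhaseFrame.frameNorm_eq_trace (hA : IsPhaseFrame A) {V : Matrix n n ℂ}
    (hV : ∀ u, 0 ≤ frameWigner A V u) : frameNorm A V = V.trace.re := by
  rw [← hA.sum_frameWigner]
  exact Finset.sum_congr rfl fun u _ => abs_of_nonneg (hV u)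

lemma IsPhaseFrame.trace_re_le (hA : IsPhaseFrame A) (V : Matrix n n ℂ) :
    V.trace.re ≤ frameNorm A V := by
  rw [← hA.sum_frameWigner]
  exact Finset.sum_le_sum fun u _ => le_abs_self _

/-- A map that sends every phase-point operator to an operator of Wigner trace norm at most one
does not increase the Wigner trace norm. -/
lemma IsPhaseFrame.frameNorm_map_le (hA : IsPhaseFrame A) (E : Matrix n n ℂ →ₗ[ℂ] Matrix m m ℂ)
    (hE : ∀ u, frameNorm B (E (A u)) ≤ 1) {V : Matrix n n ℂ} (hV : V.IsHermitian) :
    frameNorm B (E V) ≤ frameNorm A V := by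
  have h : E V = ∑ u, (frameWigner A V u : ℂ) • E (A u) := by
    conv_lhs => rw [hA.expansion_of_isHermitian hV]
    simp only [map_sum, map_smul]
  calc frameNorm B (E V)
      = ∑ v, |∑ u, frameWigner A V u * frameWigner B (E (A u)) v| := by
        rw [h]
        simp only [frameNorm, frameWigner_sum_smul]
    _ ≤ ∑ v, ∑ u, |frameWigner A V u| * |frameWigner B (E (A u)) v| := by
        refine Finset.sum_le_sum fun v _ => (Finset.abs_sum_le_sum_abs _ _).trans ?_
        simp only [abs_mul, le_refl]
    _ = ∑ u, |frameWigner A V u| * frameNorm B (E (A u)) := by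
        rw [Finset.sum_comm]
        simp only [frameNorm, Finset.mul_sum]
    _ ≤ ∑ u, |frameWigner A V u| * 1 :=
        Finset.sum_le_sum fun u _ => mul_le_mul_of_nonneg_left (hE u) (abs_nonneg _)
    _ = frameNorm A V := by simp only [mul_one, frameNorm]

lemma IsPhaseFrame.frameWigner_self (hA : IsPhaseFrame A) [DecidableEq P] (u v : P) :
    frameWigner A (A u) v = if u = v then 1 else 0 := by
  have hd : (Fintype.card n : ℝ) ≠ 0 := Nat.cast_ne_zero.2 hA.card_pos.ne'
  rw [frameWigner]
  rcases hA.trace_mul v u with ⟨h, h'⟩ | ⟨h, h'⟩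
  · rw [if_pos h.symm, h', Complex.natCast_re, div_self hd]
  · rw [if_neg (Ne.symm h), h', Complex.zero_re, zero_div]

lemma IsPhaseFrame.frameNorm_self (hA : IsPhaseFrame A) (u : P) : frameNorm A (A u) = 1 := by
  classical
  simp [frameNorm, hA.frameWigner_self, apply_ite abs]

/-- `id ⊗ N` as a linear map. -/
def idTensorLin {a b : Type} (r : Type) (N : Matrix a a ℂ →ₗ[ℂ] Matrix b b ℂ) :
    Matrix (r × a) (r × a) ℂ →ₗ[ℂ] Matrix (r × b) (r × b) ℂ where
  toFun := idTensor r N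
  map_add' X Y := by
    ext i j
    exact congrFun (congrFun (N.map_add (Matrix.of fun x y => X (i.1, x) (j.1, y))
      (Matrix.of fun x y => Y (i.1, x) (j.1, y))) i.2) j.2
  map_smul' c X := by
    ext i j
    exact congrFun (congrFun (N.map_smul c (Matrix.of fun x y => X (i.1, x) (j.1, y))) i.2) j.2

@[simp] lemma idTensorLin_apply {a b : Type} (r : Type) (N : Matrix a a ℂ →ₗ[ℂ] Matrix b b ℂ)
    (X : Matrix (r × a) (r × a) ℂ) : idTensorLin r N X = idTensor r N X := rfl

lemma idTensor_kronecker {a b : Type} (r : Type) (N : Matrix a a ℂ →ₗ[ℂ] Matrix b b ℂ)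
    (X : Matrix r r ℂ) (Y : Matrix a a ℂ) : idTensor r N (X ⊗ₖ Y) = X ⊗ₖ N Y := by
  ext i j
  have : (Matrix.of fun x y => (X ⊗ₖ Y) (i.1, x) (j.1, y)) = X i.1 j.1 • Y := rfl
  rw [idTensor, Matrix.of_apply, this, map_smul]
  rfl

lemma IsPhaseFrame.frameNorm_kron (hC : IsPhaseFrame C) (u : T) (V : Matrix m m ℂ) :
    frameNorm (kronFamily C B) (C u ⊗ₖ V) = frameNorm B V := by
  classical
  have h : ∀ v, frameWigner (kronFamily C B) (C u ⊗ₖ V) v =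
      frameWigner C (C u) v.1 * frameWigner B V v.2 := by
    intro v
    have him := trace_mul_im_eq_zero (hC.isHermitian v.1) (hC.isHermitian u)
    rw [frameWigner, kronFamily, ← Matrix.mul_kronecker_mul, Matrix.trace_kronecker,
      Complex.mul_re, him, zero_mul, sub_zero, Fintype.card_prod, Nat.cast_mul, frameWigner,
      frameWigner, mul_div_mul_comm]
  rw [frameNorm, Fintype.sum_prod_type]
  simp only [h, hC.frameWigner_self]
  simp [frameNorm, apply_ite abs]

/-- Phase points of a composite system are products, and the reference factor contributes a point
mass to the Wigner function. Hence the condition on `E` alone already controls `id ⊗ E`. -/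
lemma IsPhaseFrame.frameNorm_idTensor_le (hC : IsPhaseFrame C) (hA : IsPhaseFrame A)
    (E : Matrix n n ℂ →ₗ[ℂ] Matrix m m ℂ) (hE : ∀ u, frameNorm B (E (A u)) ≤ 1)
    {V : Matrix (r × n) (r × n) ℂ} (hV : V.IsHermitian) :
    frameNorm (kronFamily C B) (idTensor r E V) ≤ frameNorm (kronFamily C A) V := by
  refine (hC.kron hA).frameNorm_map_le (idTensorLin r E) (fun u => ?_) hV
  rw [idTensorLin_apply, kronFamily, idTensor_kronecker, hC.frameNorm_kron]
  exact hE u.2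

/-! ### Wigner-preserving maps -/

/-- The unnormalized maximally entangled vector. -/
def maxEntVec (n : Type) [DecidableEq n] : n × n → ℂ := fun x => if x.1 = x.2 then 1 else 0

lemma proj_apply {n : Type} (φ : n → ℂ) (i j : n) : proj φ i j = φ i * star (φ j) := rfl

lemma posSemidef_proj {n : Type} [Finite n] (φ : n → ℂ) : (proj φ).PosSemidef := by
  have := Fintype.ofFinite n
  exact Matrix.posSemidef_vecMulVec_self_star φ

lemma trace_proj {n : Type} [Fintype n] (φ : n → ℂ) : (proj φ).trace = star φ ⬝ᵥ φ := by
  rw [proj, Matrix.trace_vecMulVec, dotProduct_comm]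

lemma idTensor_proj_maxEntVec (F : Matrix n n ℂ →ₗ[ℂ] Matrix m m ℂ) (i j : n × m) :
    idTensor n F (proj (maxEntVec n)) i j = F (Matrix.single i.1 j.1 1) i.2 j.2 := by
  have h : (Matrix.of fun x y => proj (maxEntVec n) (i.1, x) (j.1, y)) =
      Matrix.single i.1 j.1 1 := by
    ext x y
    rw [Matrix.of_apply, proj_apply, maxEntVec, maxEntVec, Matrix.single_apply]
    simp only [ite_and]
    split_ifs <;> simp
  rw [idTensor, Matrix.of_apply, h]

/-- The Choi correspondence; it expresses the Wigner function of the Choi state through the images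
of transposed phase-point operators. -/
lemma trace_kron_mul_idTensor_maxEnt (F : Matrix n n ℂ →ₗ[ℂ] Matrix m m ℂ) (X : Matrix n n ℂ)
    (Y : Matrix m m ℂ) :
    ((X ⊗ₖ Y) * idTensor n F (proj (maxEntVec n))).trace = (Y * F Xᵀ).trace := by
  have hX : F Xᵀ = ∑ i, ∑ j, X j i • F (Matrix.single i j 1) := by
    conv_lhs => rw [Matrix.matrix_eq_sum_single Xᵀ]
    simp only [map_sum, Matrix.transpose_apply]
    refine Finset.sum_congr rfl fun i _ => Finset.sum_congr rfl fun j _ => ?_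
    rw [← map_smul, Matrix.smul_single, smul_eq_mul, mul_one]
  rw [hX]
  simp only [Matrix.trace, Matrix.diag_apply, Matrix.mul_apply, idTensor_proj_maxEntVec,
    Matrix.kroneckerMap_apply, Matrix.sum_apply, Matrix.smul_apply, smul_eq_mul,
    Fintype.sum_prod_type, Finset.mul_sum]
  rw [Finset.sum_comm]
  refine Finset.sum_congr rfl fun x _ => ?_
  rw [Finset.sum_comm]
  refine Finset.sum_congr rfl fun i _ => Finset.sum_congr rfl fun k _ =>
    Finset.sum_congr rfl fun y _ => ?_
  ring

lemma trace_proj_maxEntVec : (proj (maxEntVec n)).trace = Fintype.card n := by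
  rw [trace_proj, dotProduct, Fintype.sum_prod_type]
  simp [maxEntVec]

/-- The normalized maximally entangled state. -/
def maxEnt (n : Type) [Fintype n] [DecidableEq n] : Matrix (n × n) (n × n) ℂ :=
  (((Fintype.card n : ℝ)⁻¹ : ℝ) : ℂ) • proj (maxEntVec n)

lemma IsPhaseFrame.isState_maxEnt (hA : IsPhaseFrame A) : IsState (maxEnt n) := by
  constructor
  · refine (posSemidef_proj _).smul ?_
    exact_mod_cast inv_nonneg.2 (Nat.cast_nonneg (α := ℝ) _)
  · rw [maxEnt, Matrix.trace_smul, trace_proj_maxEntVec, smul_eq_mul]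
    push_cast
    exact inv_mul_cancel₀ hA.card_ne_zero

lemma frameWigner_idTensor_maxEnt (F : Matrix n n ℂ →ₗ[ℂ] Matrix m m ℂ) (u : P × Q) :
    frameWigner (kronFamily A B) (idTensor n F (maxEnt n)) u =
      (Fintype.card n : ℝ)⁻¹ * ((B u.2 * F (A u.1)ᵀ).trace.re / Fintype.card (n × m)) := by
  rw [frameWigner, maxEnt, ← idTensorLin_apply, map_smul, idTensorLin_apply, kronFamily,
    Matrix.mul_smul, Matrix.trace_smul, trace_kron_mul_idTensor_maxEnt, smul_eq_mul,
    Complex.re_ofReal_mul, mul_div_assoc]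

lemma idTensor_id (X : Matrix (n × m) (n × m) ℂ) : idTensor n LinearMap.id X = X := rfl

lemma IsPhaseFrame.frameWigner_maxEnt_nonneg (hA : IsPhaseFrame A) (u : P × P) :
    0 ≤ frameWigner (kronFamily A A) (maxEnt n) u := by
  rw [← idTensor_id (maxEnt n), frameWigner_idTensor_maxEnt, LinearMap.id_apply]
  obtain ⟨v, hv⟩ := hA.exists_transpose u.1
  rw [hv]
  have : 0 ≤ (A u.2 * A v).trace.re := by
    rcases hA.trace_mul u.2 v with ⟨_, h⟩ | ⟨_, h⟩ <;> simp [h]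
  positivity

end Frame

lemma frameNorm_tensor_eq {R B : QSys} (X : Op (R.tensor B)) :
    wignerTraceNorm X = frameNorm (n := R.Basis × B.Basis) (P := R.Phase × B.Phase)
      (kronFamily (phasePoint R) (phasePoint B)) X := by
  rw [← phasePoint_tensor]
  rfl

lemma wigner_tensor_eq {R B : QSys} (X : Op (R.tensor B)) (u : R.Phase × B.Phase) :
    wigner X u = frameWigner (n := R.Basis × B.Basis) (P := R.Phase × B.Phase)
      (kronFamily (phasePoint R) (phasePoint B)) X u := by
  rw [← phasePoint_tensor]
  rfl

/-- The maximally entangled state is Wigner-positive, so the Choi state of `F` is too. Its Wigner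
function at `(v, w)`, where `A_v` is the transpose of `A_u`, is a positive multiple of that of
`F(A_u)` at `w`. Thus `F(A_u)` has nonnegative Wigner function, and its norm equals its trace, one.
-/
lemma IsCPWP.wignerTraceNorm_phasePoint_le {A B : QSys} {F : SuperOp A B} (hF : IsCPWP F)
    (u : A.Phase) : wignerTraceNorm (F (phasePoint A u)) ≤ 1 := by
  have hA := isPhaseFrame_phasePoint A
  have hB := isPhaseFrame_phasePoint B
  have hΦ : (maxEnt A.Basis : Op (A.tensor A)) ∈ PosWigner (A.tensor A) :=
    ⟨hA.isState_maxEnt, fun u =>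
      (hA.frameWigner_maxEnt_nonneg u).trans_eq (wigner_tensor_eq _ u).symm⟩
  have h := (hF.2 A _ hΦ).2
  obtain ⟨v, hv⟩ := hA.exists_transpose u
  have hpos : ∀ w, 0 ≤ frameWigner (phasePoint B) (F (phasePoint A u)) w := by
    intro w
    have h1 := h ((v, w) : A.Phase × B.Phase)
    have h2 := (wigner_tensor_eq (applyRight A F (maxEnt A.Basis)) (v, w)).symm.trans_ge h1
    have h3 : frameWigner (kronFamily (phasePoint A) (phasePoint B))
      (idTensor A.Basis F (maxEnt A.Basis)) (v, w) ≥ 0 := h2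
    rw [frameWigner_idTensor_maxEnt, ← hv, Matrix.transpose_transpose] at h3
    have hcA : (0 : ℝ) < Fintype.card A.Basis := Nat.cast_pos.2 hA.card_pos
    have hcB : (0 : ℝ) < Fintype.card B.Basis := Nat.cast_pos.2 hB.card_pos
    have h4 := nonneg_of_mul_nonneg_right h3 (inv_pos.2 hcA)
    rw [Fintype.card_prod, Nat.cast_mul] at h4
    have h5 : 0 ≤ (phasePoint B w * F (phasePoint A u)).trace.re := by
      by_contra hneg
      exact absurd h4 (not_le.2 (div_neg_of_neg_of_pos (not_le.1 hneg) (mul_pos hcA hcB)))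
    exact div_nonneg h5 hcB.le
  rw [wignerTraceNorm_eq_frameNorm, hB.frameNorm_eq_trace hpos, hF.1.2, hA.trace_eq_one]
  simp

lemma wignerTraceNorm_map_le {A B : QSys} {E : SuperOp A B}
    (hE : ∀ u, wignerTraceNorm (E (phasePoint A u)) ≤ 1) {V : Op A} (hV : V.IsHermitian) :
    wignerTraceNorm (E V) ≤ wignerTraceNorm V :=
  (isPhaseFrame_phasePoint A).frameNorm_map_le E hE hV

lemma wignerTraceNorm_applyRight_le {A B : QSys} (R : QSys) {E : SuperOp A B}
    (hE : ∀ u, wignerTraceNorm (E (phasePoint A u)) ≤ 1) {V : Op (R.tensor A)}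
    (hV : V.IsHermitian) : wignerTraceNorm (applyRight R E V) ≤ wignerTraceNorm V := by
  rw [frameNorm_tensor_eq, frameNorm_tensor_eq]
  exact (isPhaseFrame_phasePoint R).frameNorm_idTensor_le (isPhaseFrame_phasePoint A) E hE hV

/-! ### Functional calculus for Hermitian matrices -/

section Spectral

variable {n m : Type} [Fintype n] [DecidableEq n] [Fintype m] [DecidableEq m]

lemma posSemidef_ofReal_smul {X : Matrix n n ℂ} (hX : X.PosSemidef) {c : ℝ} (hc : 0 ≤ c) :
    ((c : ℂ) • X).PosSemidef :=
  hX.smul (by exact_mod_cast hc)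

lemma trace_re_nonneg {X : Matrix n n ℂ} (hX : X.PosSemidef) : 0 ≤ X.trace.re :=
  (Complex.le_def.1 hX.trace_nonneg).1

/-- One family `e` serves every `f`, so functional calculus reduces to finite sums. -/
lemma exists_spectral {M : Matrix n n ℂ} (hM : M.IsHermitian) :
    ∃ e : n → n → ℂ, ∀ f : ℝ → ℝ, cfc f M = ∑ j, (f (hM.eigenvalues j) : ℂ) • proj (e j) := by
  refine ⟨fun j i => hM.eigenvectorUnitary.1 i j, fun f => ?_⟩
  rw [hM.cfc_eq f, Matrix.IsHermitian.cfc, Unitary.conjStarAlgAut_apply]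
  ext i k
  rw [Matrix.mul_apply, Matrix.sum_apply]
  refine Finset.sum_congr rfl fun j _ => ?_
  rw [Matrix.mul_diagonal, Matrix.smul_apply, proj_apply, smul_eq_mul]
  simp only [Function.comp_apply, Matrix.star_apply, Complex.coe_algebraMap]
  ring

lemma cfc_mul_cfc {M : Matrix n n ℂ} (f g : ℝ → ℝ) :
    cfc f M * cfc g M = cfc (fun x => f x * g x) M :=
  (cfc_mul f g M (M.finite_real_spectrum.continuousOn _)
    (M.finite_real_spectrum.continuousOn _)).symm

lemma isHermitian_cfc (f : ℝ → ℝ) (M : Matrix n n ℂ) : (cfc f M).IsHermitian :=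
  cfc_predicate f M

lemma cfc_congr_eigenvalues {M : Matrix n n ℂ} (hM : M.IsHermitian) {f g : ℝ → ℝ}
    (h : ∀ j, f (hM.eigenvalues j) = g (hM.eigenvalues j)) : cfc f M = cfc g M := by
  obtain ⟨e, he⟩ := exists_spectral hM
  simp only [he, h]

lemma cfc_id_eq {M : Matrix n n ℂ} (hM : M.IsHermitian) : cfc (fun x : ℝ => x) M = M :=
  cfc_id' ℝ M hM

lemma cfc_one_eq {M : Matrix n n ℂ} (hM : M.IsHermitian) : cfc (fun _ : ℝ => (1 : ℝ)) M = 1 :=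
  cfc_const_one ℝ M hM

variable {σ : Matrix n n ℂ}

lemma matPow_half_mul_self (hσ : σ.PosSemidef) : matPow σ (1 / 2) * matPow σ (1 / 2) = σ := by
  rw [matPow, cfc_mul_cfc]
  conv_rhs => rw [← cfc_id_eq hσ.1]
  refine cfc_congr_eigenvalues hσ.1 fun j => ?_
  rw [← Real.sqrt_eq_rpow, Real.mul_self_sqrt (hσ.eigenvalues_nonneg j)]

/-- The convention `0 ^ s = 0` for `s ≠ 0` yields the support indicator rather than one. -/
lemma rpow_half_mul_rpow_neg_half {x : ℝ} (hx : 0 ≤ x) :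
    x ^ (1 / 2 : ℝ) * x ^ (-1 / 2 : ℝ) = if x = 0 then 0 else 1 := by
  split_ifs with h
  · rw [h, Real.zero_rpow (by norm_num), zero_mul]
  · rw [← Real.rpow_add (lt_of_le_of_ne hx (Ne.symm h))]
    norm_num

lemma matPow_half_mul_neg_half (hσ : σ.PosSemidef) :
    matPow σ (1 / 2) * matPow σ (-1 / 2) = suppProj σ := by
  rw [matPow, matPow, cfc_mul_cfc]
  exact cfc_congr_eigenvalues hσ.1 fun j => rpow_half_mul_rpow_neg_half (hσ.eigenvalues_nonneg j)

lemma matPow_neg_half_mul_half (hσ : σ.PosSemidef) :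
    matPow σ (-1 / 2) * matPow σ (1 / 2) = suppProj σ := by
  rw [matPow, matPow, cfc_mul_cfc]
  refine cfc_congr_eigenvalues hσ.1 fun j => ?_
  rw [mul_comm]
  exact rpow_half_mul_rpow_neg_half (hσ.eigenvalues_nonneg j)

lemma suppProj_mul_self (σ : Matrix n n ℂ) : suppProj σ * suppProj σ = suppProj σ := by
  rw [suppProj, cfc_mul_cfc]
  congr 1
  funext x
  split_ifs <;> simp

lemma isHermitian_suppProj (σ : Matrix n n ℂ) : (suppProj σ).IsHermitian := isHermitian_cfc _ _

lemma mul_suppProj (hσ : σ.IsHermitian) : σ * suppProj σ = σ := by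
  have h : cfc (fun x : ℝ => x) σ * suppProj σ = cfc (fun x : ℝ => x) σ := by
    rw [suppProj, cfc_mul_cfc]
    congr 1
    funext x
    split_ifs with h <;> simp [h]
  rwa [cfc_id_eq hσ] at h

lemma posSemidef_one_sub_suppProj (σ : Matrix n n ℂ) : (1 - suppProj σ).PosSemidef := by
  have h : 1 - suppProj σ = (1 - suppProj σ)ᴴ * (1 - suppProj σ) := by
    rw [Matrix.conjTranspose_sub, Matrix.conjTranspose_one, (isHermitian_suppProj σ).eq,
      mul_sub, sub_mul, sub_mul, suppProj_mul_self]
    simp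
  rw [h]
  exact Matrix.posSemidef_conjTranspose_mul_self _

lemma SuppLE.mul_suppProj {ρ : Matrix n n ℂ} (h : SuppLE ρ σ) (hσ : σ.IsHermitian) :
    ρ * suppProj σ = ρ := by
  have h0 : σ * (1 - suppProj σ) = 0 := by rw [mul_sub, Magic.mul_suppProj hσ, mul_one, sub_self]
  have h1 : ρ * (1 - suppProj σ) = 0 := by
    refine Matrix.ext_of_mulVec_single fun i => ?_
    rw [← Matrix.mulVec_mulVec, h _ (by rw [Matrix.mulVec_mulVec, h0, Matrix.zero_mulVec]),
      Matrix.zero_mulVec]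
  rw [mul_sub, mul_one, sub_eq_zero] at h1
  exact h1.symm

lemma posSemidef_trace_mul_re_nonneg {X Y : Matrix n n ℂ} (hX : X.PosSemidef)
    (hY : Y.PosSemidef) : 0 ≤ (X * Y).trace.re := by
  have h := matPow_half_mul_self hY
  have hH : (matPow Y (1 / 2))ᴴ = matPow Y (1 / 2) := isHermitian_cfc _ _
  rw [← h, ← mul_assoc, Matrix.trace_mul_comm, ← mul_assoc]
  have := hX.mul_mul_conjTranspose_same (matPow Y (1 / 2))
  rw [hH] at this
  exact trace_re_nonneg this

lemma exists_sum_proj (hσ : σ.PosSemidef) :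
    ∃ v : n → n → ℂ, σ = ∑ j, proj (v j) := by
  obtain ⟨e, he⟩ := exists_spectral hσ.1
  refine ⟨fun j => ((Real.sqrt (hσ.1.eigenvalues j) : ℝ) : ℂ) • e j, ?_⟩
  conv_lhs => rw [← cfc_id_eq hσ.1, he]
  refine Finset.sum_congr rfl fun j _ => ?_
  ext i k
  simp only [Matrix.smul_apply, proj_apply, Pi.smul_apply, smul_eq_mul, star_mul',
    Complex.star_def, Complex.conj_ofReal]
  rw [mul_mul_mul_comm, ← Complex.ofReal_mul, Real.mul_self_sqrt (hσ.eigenvalues_nonneg j)]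

/-- Simultaneous diagonalization of a pair of positive semidefinite matrices by congruence. -/
lemma exists_geometric_decomposition {ρ : Matrix n n ℂ} (hρ : ρ.PosSemidef) (hσ : σ.PosSemidef)
    (hs : SuppLE ρ σ) (α : ℝ) :
    ∃ (κ : n → Matrix n n ℂ) (r : n → ℝ), (∀ j, (κ j).PosSemidef) ∧ (∀ j, 0 ≤ r j) ∧
      ρ = ∑ j, (r j : ℂ) • κ j ∧ σ = ∑ j, κ j ∧
      (matPow σ (1 / 2) * matPow (matPow σ (-1 / 2) * ρ * matPow σ (-1 / 2)) α *
        matPow σ (1 / 2)).trace.re = ∑ j, r j ^ α * (κ j).trace.re ∧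
      ∀ t : ℝ, 0 ≤ t → ((t : ℂ) • σ - ρ).PosSemidef → ∀ j, r j ≤ t := by
  set h := matPow σ (1 / 2) with hh
  set g := matPow σ (-1 / 2) with hg
  have hH : hᴴ = h := isHermitian_cfc _ _
  have gH : gᴴ = g := isHermitian_cfc _ _
  have hM : (g * ρ * g).PosSemidef := by
    have := hρ.mul_mul_conjTranspose_same g
    rwa [gH] at this
  obtain ⟨e, he⟩ := exists_spectral hM.1
  have hρs := hs.mul_suppProj hσ.1
  have hsρ : suppProj σ * ρ = ρ := by
    have := congrArg Matrix.conjTranspose hρs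
    rwa [Matrix.conjTranspose_mul, hρ.1.eq, (isHermitian_suppProj σ).eq] at this
  have hfun (f : ℝ → ℝ) : h * cfc f (g * ρ * g) * h =
      ∑ j, (f (hM.1.eigenvalues j) : ℂ) • (h * proj (e j) * h) := by
    rw [he, Finset.mul_sum, Finset.sum_mul]
    simp only [Matrix.mul_smul, Matrix.smul_mul]
  -- The atoms are `σ^{1/2} |eⱼ⟩⟨eⱼ| σ^{1/2}`, weighted by the eigenvalues of `σ^{-1/2} ρ σ^{-1/2}`.
  refine ⟨fun j => h * proj (e j) * h, hM.1.eigenvalues, fun j => ?_, hM.eigenvalues_nonneg,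
    ?_, ?_, ?_, ?_⟩
  · have := (posSemidef_proj (e j)).mul_mul_conjTranspose_same h
    rwa [hH] at this
  · rw [← hfun fun x => x, cfc_id_eq hM.1]
    calc ρ = suppProj σ * ρ * suppProj σ := by rw [hsρ, hρs]
      _ = h * g * ρ * (g * h) := by
        rw [hh, hg, matPow_half_mul_neg_half hσ, matPow_neg_half_mul_half hσ]
      _ = _ := by simp only [mul_assoc]
  · have := hfun fun _ => 1
    rw [cfc_one_eq hM.1, mul_one, show h * h = σ from matPow_half_mul_self hσ] at this
    simpa only [Complex.ofReal_one, one_smul] using this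
  · rw [matPow, hfun, Matrix.trace_sum, Complex.re_sum]
    refine Finset.sum_congr rfl fun j _ => ?_
    rw [Matrix.trace_smul, smul_eq_mul, Complex.re_ofReal_mul]
  · intro t ht hle j
    have h1 : ((t : ℂ) • suppProj σ - g * ρ * g).PosSemidef := by
      have := hle.mul_mul_conjTranspose_same g
      have hgσ : g * σ * g = suppProj σ := by
        conv_lhs => rw [← matPow_half_mul_self hσ]
        rw [← hh, ← mul_assoc, mul_assoc (g * h), hg, hh, matPow_half_mul_neg_half hσ,
          matPow_neg_half_mul_half hσ, suppProj_mul_self]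
      rwa [gH, mul_sub, sub_mul, Matrix.mul_smul, Matrix.smul_mul, hgσ] at this
    -- Congruence by `σ^{-1/2}` only gives `t` times the support projector; `t ≥ 0` allows passing
    -- to `t • 1`, after which Rayleigh quotients bound the eigenvalues.
    have h2 : ((t : ℂ) • 1 - g * ρ * g).PosSemidef := by
      have := h1.add (posSemidef_ofReal_smul (posSemidef_one_sub_suppProj σ) ht)
      convert this using 1
      rw [smul_sub]
      abel
    have h3 := hM.1.eigenvalues_eq j
    have h4 := (Complex.le_def.1
      (h2.dotProduct_mulVec_nonneg (hM.1.eigenvectorBasis j).ofLp)).1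
    rw [Matrix.sub_mulVec, dotProduct_sub, Matrix.smul_mulVec, Matrix.one_mulVec,
      dotProduct_smul, Complex.sub_re, smul_eq_mul, Complex.re_ofReal_mul] at h4
    have h5 : star (hM.1.eigenvectorBasis j).ofLp ⬝ᵥ (hM.1.eigenvectorBasis j).ofLp = 1 := by
      have := hM.1.eigenvectorBasis.inner_eq_ite j j
      rw [EuclideanSpace.inner_eq_star_dotProduct, if_pos rfl, dotProduct_comm] at this
      exact this
    rw [h5] at h4
    have h6 : hM.1.eigenvalues j = (star (hM.1.eigenvectorBasis j).ofLp ⬝ᵥ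
      (g * ρ * g) *ᵥ (hM.1.eigenvectorBasis j).ofLp).re := h3
    rw [h6]
    simpa using h4

end Spectral

/-! ### Reverse tests -/

/-- `RevTest α ρ σ C`: the pair `(ρ, σ)` is the image of a pair of finite measures under a positive
map, with `∑ pᵢ ^ α qᵢ ^ (1 - α) ≤ C`. The least such `C` is the geometric Rényi quantity. -/
def RevTest {n : Type} [Fintype n] (α : ℝ) (ρ σ : Matrix n n ℂ) (C : ℝ) : Prop :=
  ∃ (ι : Type) (_ : Fintype ι) (r : ι → ℝ) (τ : ι → Matrix n n ℂ), (∀ i, 0 ≤ r i) ∧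
    (∀ i, (τ i).PosSemidef) ∧ ρ = ∑ i, (r i : ℂ) • τ i ∧ σ = ∑ i, τ i ∧
    ∑ i, r i ^ α * (τ i).trace.re ≤ C

namespace RevTest

variable {n m : Type} [Fintype n] [DecidableEq n] [Fintype m] [DecidableEq m] {α : ℝ}
  {ρ σ ρ' σ' : Matrix n n ℂ} {C C' : ℝ}

lemma mono (h : RevTest α ρ σ C) (hC : C ≤ C') : RevTest α ρ σ C' := by
  obtain ⟨ι, _, r, τ, h1, h2, h3, h4, h5⟩ := h
  exact ⟨ι, _, r, τ, h1, h2, h3, h4, h5.trans hC⟩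

lemma refl (hσ : σ.PosSemidef) : RevTest α σ σ σ.trace.re :=
  ⟨Unit, inferInstance, fun _ => 1, fun _ => σ, fun _ => zero_le_one, fun _ => hσ, by simp,
    by simp, by simp⟩

lemma zero : RevTest α (0 : Matrix n n ℂ) 0 0 :=
  ⟨Empty, inferInstance, fun _ => 1, fun _ => 0, fun _ => zero_le_one,
    fun _ => Matrix.PosSemidef.zero, by simp, by simp, by simp⟩

lemma add (h : RevTest α ρ σ C) (h' : RevTest α ρ' σ' C') :
    RevTest α (ρ + ρ') (σ + σ') (C + C') := by
  obtain ⟨ι, _, r, τ, h1, h2, h3, h4, h5⟩ := h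
  obtain ⟨ι', _, r', τ', h1', h2', h3', h4', h5'⟩ := h'
  refine ⟨ι ⊕ ι', inferInstance, Sum.elim r r', Sum.elim τ τ', ?_, ?_, ?_, ?_, ?_⟩
  · rintro (i | i)
    exacts [h1 i, h1' i]
  · rintro (i | i)
    exacts [h2 i, h2' i]
  · simp [h3, h3']
  · simp [h4, h4']
  · simpa using add_le_add h5 h5'

lemma sum {ι : Type} (s : Finset ι) {ρ σ : ι → Matrix n n ℂ} {C : ι → ℝ}
    (h : ∀ i ∈ s, RevTest α (ρ i) (σ i) (C i)) :
    RevTest α (∑ i ∈ s, ρ i) (∑ i ∈ s, σ i) (∑ i ∈ s, C i) := by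
  classical
  induction s using Finset.induction_on with
  | empty => simpa using zero
  | insert i s hi ih =>
    rw [Finset.sum_insert hi, Finset.sum_insert hi, Finset.sum_insert hi]
    exact (h i (Finset.mem_insert_self i s)).add
      (ih fun j hj => h j (Finset.mem_insert_of_mem hj))

lemma smul_left (h : RevTest α ρ σ C) {c : ℝ} (hc : 0 ≤ c) :
    RevTest α ((c : ℂ) • ρ) σ (c ^ α * C) := by
  obtain ⟨ι, _, r, τ, h1, h2, h3, h4, h5⟩ := h
  refine ⟨ι, _, fun i => c * r i, τ, fun i => mul_nonneg hc (h1 i), h2, ?_, h4, ?_⟩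
  · rw [h3, Finset.smul_sum]
    simp only [smul_smul, Complex.ofReal_mul]
  · simp only [Real.mul_rpow hc (h1 _), mul_assoc]
    rw [← Finset.mul_sum]
    exact mul_le_mul_of_nonneg_left h5 (Real.rpow_nonneg hc _)

/-- Data processing: the weights stay and only the atoms move, so positivity and trace non-increase
suffice. -/
lemma map (h : RevTest α ρ σ C) (Φ : Matrix n n ℂ →ₗ[ℂ] Matrix m m ℂ)
    (hΦ : ∀ X, X.PosSemidef → (Φ X).PosSemidef)
    (hΦ' : ∀ X, X.PosSemidef → (Φ X).trace.re ≤ X.trace.re) : RevTest α (Φ ρ) (Φ σ) C := by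
  obtain ⟨ι, inst, r, τ, h1, h2, h3, h4, h5⟩ := h
  refine ⟨ι, inst, r, fun i => Φ (τ i), h1, fun i => hΦ _ (h2 i), ?_, ?_, le_trans ?_ h5⟩
  · rw [h3, map_sum]
    simp only [map_smul]
  · rw [h4, map_sum]
  · exact Finset.sum_le_sum fun i _ =>
      mul_le_mul_of_nonneg_left (hΦ' _ (h2 i)) (Real.rpow_nonneg (h1 i) _)

lemma smul (h : RevTest α ρ σ C) {c : ℝ} (hc : 0 ≤ c) :
    RevTest α ((c : ℂ) • ρ) ((c : ℂ) • σ) (c * C) := by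
  obtain ⟨ι, inst, r, τ, h1, h2, h3, h4, h5⟩ := h
  refine ⟨ι, inst, r, fun i => (c : ℂ) • τ i, h1, fun i => posSemidef_ofReal_smul (h2 i) hc, ?_, ?_, ?_⟩
  · rw [h3, Finset.smul_sum]
    simp only [smul_smul, mul_comm]
  · rw [h4, Finset.smul_sum]
  · simp only [Matrix.trace_smul, smul_eq_mul, Complex.re_ofReal_mul, mul_left_comm _ c]
    rw [← Finset.mul_sum]
    exact mul_le_mul_of_nonneg_left h5 hc

/-- The fidelity with a test bounds the cost of any reverse test from below. -/
lemma trace_mul_le (h : RevTest α ρ σ C) (hα : 1 < α) {P : Matrix n n ℂ} (hP : P.PosSemidef)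
    (hP' : (1 - P).PosSemidef) :
    (ρ * P).trace.re ≤ (σ * P).trace.re ^ (1 - α⁻¹) * C ^ α⁻¹ := by
  obtain ⟨ι, _, r, τ, h1, h2, rfl, rfl, h5⟩ := h
  have hw (i : ι) : 0 ≤ (τ i * P).trace.re := posSemidef_trace_mul_re_nonneg (h2 i) hP
  have hw' (i : ι) : (τ i * P).trace.re ≤ (τ i).trace.re := by
    have := posSemidef_trace_mul_re_nonneg (h2 i) hP'
    rw [mul_sub, mul_one, Matrix.trace_sub, Complex.sub_re] at this
    linarith
  -- Hölder for the function `r` with weights `tr[τᵢ P]`; afterwards `P ≤ 1` replaces these by `tr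
  -- τᵢ` in the `α`-th moment.
  have key := Real.inner_le_weight_mul_Lp_of_nonneg Finset.univ hα.le
    (fun i => (τ i * P).trace.re) r hw h1
  have e1 : ((∑ i, (r i : ℂ) • τ i) * P).trace.re = ∑ i, (τ i * P).trace.re * r i := by
    simp only [Finset.sum_mul, Matrix.trace_sum, Complex.re_sum, Matrix.smul_mul,
      Matrix.trace_smul, smul_eq_mul, Complex.re_ofReal_mul, mul_comm]
  have e2 : ((∑ i, τ i) * P).trace.re = ∑ i, (τ i * P).trace.re := by
    simp only [Finset.sum_mul, Matrix.trace_sum, Complex.re_sum]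
  rw [e1, e2]
  refine key.trans (mul_le_mul_of_nonneg_left ?_
    (Real.rpow_nonneg (Finset.sum_nonneg fun i _ => hw i) _))
  refine Real.rpow_le_rpow
    (Finset.sum_nonneg fun i _ => mul_nonneg (hw i) (Real.rpow_nonneg (h1 i) _)) ?_
    (inv_nonneg.2 (by linarith))
  refine le_trans (Finset.sum_le_sum fun i _ => ?_) h5
  rw [mul_comm]
  exact mul_le_mul_of_nonneg_left (hw' i) (Real.rpow_nonneg (h1 i) _)

end RevTest

/-! ### The chain rule -/

section Chain

variable {a b r : Type} [Fintype a] [DecidableEq a] [Fintype b] [DecidableEq b] [Fintype r]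
  [DecidableEq r] {α : ℝ}

/-- Polar decomposition of a rectangular matrix. -/
lemma exists_polar (V : Matrix r a ℂ) : ∃ (K : Matrix r a ℂ) (Φ : Matrix a a ℂ),
    V = K * Φ ∧ Φᴴ * Φ = Vᴴ * V ∧ (1 - Kᴴ * K).PosSemidef := by
  have hH : (Vᴴ * V).PosSemidef := Matrix.posSemidef_conjTranspose_mul_self V
  have h1 : (matPow (Vᴴ * V) (1 / 2))ᴴ = matPow (Vᴴ * V) (1 / 2) := isHermitian_cfc _ _
  have h2 : (matPow (Vᴴ * V) (-1 / 2))ᴴ = matPow (Vᴴ * V) (-1 / 2) := isHermitian_cfc _ _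
  refine ⟨V * matPow (Vᴴ * V) (-1 / 2), matPow (Vᴴ * V) (1 / 2), ?_, ?_, ?_⟩
  · rw [Matrix.mul_assoc, matPow_neg_half_mul_half hH]
    -- `V` and `Vᴴ V` have the same kernel, so the pseudo-inverse of `|V|` loses nothing.
    have h3 : Vᴴ * V * (1 - suppProj (Vᴴ * V)) = 0 := by
      rw [mul_sub, mul_suppProj hH.1, mul_one, sub_self]
    rw [Matrix.conjTranspose_mul_self_mul_eq_zero, Matrix.mul_sub, Matrix.mul_one,
      sub_eq_zero] at h3
    exact h3
  · rw [h1, matPow_half_mul_self hH]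
  · have h4 : (V * matPow (Vᴴ * V) (-1 / 2))ᴴ * (V * matPow (Vᴴ * V) (-1 / 2)) =
        suppProj (Vᴴ * V) := by
      rw [Matrix.conjTranspose_mul, h2]
      calc _ = matPow (Vᴴ * V) (-1 / 2) * (Vᴴ * V) * matPow (Vᴴ * V) (-1 / 2) := by
            simp only [Matrix.mul_assoc]
        _ = matPow (Vᴴ * V) (-1 / 2) * (matPow (Vᴴ * V) (1 / 2) * matPow (Vᴴ * V) (1 / 2)) *
            matPow (Vᴴ * V) (-1 / 2) := by rw [matPow_half_mul_self hH]
        _ = (matPow (Vᴴ * V) (-1 / 2) * matPow (Vᴴ * V) (1 / 2)) * (matPow (Vᴴ * V) (1 / 2) *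
            matPow (Vᴴ * V) (-1 / 2)) := by simp only [Matrix.mul_assoc]
        _ = _ := by
          rw [matPow_half_mul_neg_half hH, matPow_neg_half_mul_half hH, suppProj_mul_self]
    rw [h4]
    exact posSemidef_one_sub_suppProj _

lemma kronecker_one_mul_apply {c : Type} (K : Matrix r a ℂ) (M : Matrix (a × b) c ℂ)
    (i : r × b) (z : c) :
    ((K ⊗ₖ (1 : Matrix b b ℂ)) * M) i z = ∑ k, K i.1 k * M (k, i.2) z := by
  rw [Matrix.mul_apply, Fintype.sum_prod_type]
  refine Finset.sum_congr rfl fun k _ => ?_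
  rw [Finset.sum_eq_single i.2]
  · rw [Matrix.kroneckerMap_apply, Matrix.one_apply_eq, mul_one]
  · intro x _ hx
    rw [Matrix.kroneckerMap_apply, Matrix.one_apply_ne (Ne.symm hx), mul_zero, zero_mul]
  · simp

lemma mul_conjTranspose_kronecker_one_apply {c : Type} (K : Matrix r a ℂ)
    (M : Matrix c (a × b) ℂ) (z : c) (j : r × b) :
    (M * (K ⊗ₖ (1 : Matrix b b ℂ))ᴴ) z j = ∑ l, M z (l, j.2) * star (K j.1 l) := by
  have h := congrArg star (kronecker_one_mul_apply K Mᴴ j z)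
  rw [← Matrix.conjTranspose_apply, Matrix.conjTranspose_mul, Matrix.conjTranspose_conjTranspose]
    at h
  rw [h, star_sum]
  refine Finset.sum_congr rfl fun l _ => ?_
  rw [star_mul', Matrix.conjTranspose_apply, star_star, mul_comm]

/-- Operators on the reference commute with maps on the other factor. -/
lemma idTensor_conj (N : Matrix a a ℂ →ₗ[ℂ] Matrix b b ℂ) (K : Matrix r a ℂ)
    (φ : a × a → ℂ) :
    idTensor r N (proj fun x : r × a => ∑ k, K x.1 k * φ (k, x.2)) =
      (K ⊗ₖ (1 : Matrix b b ℂ)) * idTensor a N (proj φ) * (K ⊗ₖ (1 : Matrix b b ℂ))ᴴ := by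
  ext ⟨i, x⟩ ⟨j, y⟩
  have h : (Matrix.of fun s t => proj (fun x : r × a => ∑ k, K x.1 k * φ (k, x.2)) (i, s) (j, t)) =
      ∑ k, ∑ l, (K i k * star (K j l)) • Matrix.of fun s t => proj φ (k, s) (l, t) := by
    ext s t
    simp only [Matrix.of_apply, proj_apply, Matrix.sum_apply, Matrix.smul_apply, smul_eq_mul,
      star_sum, star_mul', Finset.sum_mul_sum]
    refine Finset.sum_congr rfl fun k _ => Finset.sum_congr rfl fun l _ => ?_
    ring
  have h' : idTensor r N (proj fun x : r × a => ∑ k, K x.1 k * φ (k, x.2)) (i, x) (j, y) =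
      ∑ k, ∑ l, (K i k * star (K j l)) * idTensor a N (proj φ) (k, x) (l, y) := by
    rw [idTensor, Matrix.of_apply, h]
    simp only [map_sum, map_smul, Matrix.sum_apply, Matrix.smul_apply, smul_eq_mul]
    rfl
  rw [h', mul_conjTranspose_kronecker_one_apply]
  simp only [kronecker_one_mul_apply, Finset.sum_mul]
  rw [Finset.sum_comm]
  refine Finset.sum_congr rfl fun k _ => Finset.sum_congr rfl fun l _ => ?_
  ring

lemma posSemidef_one_sub_kronecker {K : Matrix r a ℂ} (hK : (1 - Kᴴ * K).PosSemidef) :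
    (1 - (K ⊗ₖ (1 : Matrix b b ℂ))ᴴ * (K ⊗ₖ (1 : Matrix b b ℂ))).PosSemidef := by
  have h := hK.kronecker (Matrix.PosSemidef.one (n := b) (R := ℂ))
  rw [Matrix.conjTranspose_kronecker, ← Matrix.mul_kronecker_mul, Matrix.conjTranspose_one,
    mul_one]
  have h' : (1 - Kᴴ * K) ⊗ₖ (1 : Matrix b b ℂ) = 1 - (Kᴴ * K) ⊗ₖ (1 : Matrix b b ℂ) := by
    rw [← Matrix.one_kronecker_one (m := a) (n := b)]
    ext i j
    simp only [Matrix.kroneckerMap_apply, Matrix.sub_apply, sub_mul]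
  rwa [h'] at h

lemma RevTest.contract {n m : Type} [Fintype n] [DecidableEq n] [Fintype m] [DecidableEq m]
    {ρ σ : Matrix n n ℂ} {C : ℝ} (h : RevTest α ρ σ C) {W : Matrix m n ℂ}
    (hW : (1 - Wᴴ * W).PosSemidef) : RevTest α (W * ρ * Wᴴ) (W * σ * Wᴴ) C := by
  let Φ : Matrix n n ℂ →ₗ[ℂ] Matrix m m ℂ :=
    { toFun := fun X => W * X * Wᴴ
      map_add' := fun X Y => by rw [Matrix.mul_add, Matrix.add_mul]
      map_smul' := fun c X => by
        rw [Matrix.mul_smul, Matrix.smul_mul, RingHom.id_apply] }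
  refine h.map Φ (fun X hX => hX.mul_mul_conjTranspose_same W) fun X hX => ?_
  have h1 := posSemidef_trace_mul_re_nonneg hW hX
  rw [sub_mul, one_mul, Matrix.trace_sub, Complex.sub_re, Matrix.mul_assoc,
    Matrix.trace_mul_comm] at h1
  exact sub_nonneg.1 h1

/-- A bound on the outputs for all pure states of a copy of the input and the input extends to pure
inputs with an arbitrary reference system. -/
lemma revTest_idTensor_proj {N E : Matrix a a ℂ →ₗ[ℂ] Matrix b b ℂ} {L : ℝ}
    (h : ∀ φ : a × a → ℂ, star φ ⬝ᵥ φ = 1 →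
      RevTest α (idTensor a N (proj φ)) (idTensor a E (proj φ)) L) (v : r × a → ℂ) :
    RevTest α (idTensor r N (proj v)) (idTensor r E (proj v)) (L * (proj v).trace.re) := by
  -- A Schmidt-type reduction: `v` arises from a vector `φ` of the same norm on two copies of the
  -- input by a contraction `K` on the reference, and contractions preserve reverse tests.
  obtain ⟨K, Φ, hV, hΦ, hK⟩ := exists_polar (Matrix.of fun i x => v (i, x))
  set φ : a × a → ℂ := fun x => Φ x.1 x.2 with hφ
  have hv : v = fun x => ∑ k, K x.1 k * φ (k, x.2) := by
    funext x
    exact congrFun (congrFun hV x.1) x.2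
  have htr {s : Type} [Fintype s] (M : Matrix s a ℂ) :
      (Mᴴ * M).trace = (proj fun x : s × a => M x.1 x.2).trace := by
    rw [trace_proj, dotProduct, Fintype.sum_prod_type_right]
    rfl
  have hn : (proj v).trace = (proj φ).trace := by
    rw [hφ, ← htr, hΦ, htr]
    rfl
  have hφL : RevTest α (idTensor a N (proj φ)) (idTensor a E (proj φ))
      (L * (proj φ).trace.re) := by
    have h0 := trace_re_nonneg (posSemidef_proj φ)
    have him : (proj φ).trace.im = 0 := (Complex.le_def.1 (posSemidef_proj φ).trace_nonneg).2.symm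
    rcases h0.eq_or_lt with h1 | h1
    · have h2 : (proj φ).trace = 0 := Complex.ext h1.symm him
      rw [trace_proj, dotProduct_star_self_eq_zero] at h2
      have h3 : proj φ = 0 := by
        rw [h2]
        ext i j
        simp [proj_apply]
      rw [h3, ← idTensorLin_apply, ← idTensorLin_apply, map_zero, map_zero]
      simpa using RevTest.zero
    · set c := (proj φ).trace.re with hc
      have hc' : (proj φ).trace = (c : ℂ) := Complex.ext rfl him
      set ψ : a × a → ℂ := (((Real.sqrt c)⁻¹ : ℝ) : ℂ) • φ with hψ
      have h2 : proj φ = (c : ℂ) • proj ψ := by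
        ext i j
        simp only [hψ, Matrix.smul_apply, proj_apply, Pi.smul_apply, smul_eq_mul, star_mul',
          Complex.star_def, Complex.conj_ofReal]
        rw [mul_mul_mul_comm, ← mul_assoc, ← Complex.ofReal_mul, ← Complex.ofReal_mul, ← mul_inv,
          Real.mul_self_sqrt h0, mul_inv_cancel₀ h1.ne', Complex.ofReal_one, one_mul]
      have h3 : star ψ ⬝ᵥ ψ = 1 := by
        have h4 := congrArg Matrix.trace h2
        rw [hc', Matrix.trace_smul, smul_eq_mul, trace_proj] at h4
        have hcne : (c : ℂ) ≠ 0 := Complex.ofReal_ne_zero.2 h1.ne'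
        exact mul_left_cancel₀ hcne (by rw [← h4, mul_one])
      rw [h2, ← idTensorLin_apply, ← idTensorLin_apply, map_smul, map_smul, mul_comm]
      exact (h ψ h3).smul h0
  rw [hn, hv, idTensor_conj, idTensor_conj]
  exact hφL.contract (posSemidef_one_sub_kronecker hK)

/-- The chain rule: the costs of reverse tests of states and of maps multiply. -/
lemma RevTest.chain {N E : Matrix a a ℂ →ₗ[ℂ] Matrix b b ℂ} {L : ℝ} (hL : 0 ≤ L)
    (h : ∀ φ : a × a → ℂ, star φ ⬝ᵥ φ = 1 →
      RevTest α (idTensor a N (proj φ)) (idTensor a E (proj φ)) L)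
    {ρ σ : Matrix (r × a) (r × a) ℂ} {C : ℝ} (hρ : RevTest α ρ σ C) :
    RevTest α (idTensor r N ρ) (idTensor r E σ) (L * C) := by
  have hpsd (τ : Matrix (r × a) (r × a) ℂ) (hτ : τ.PosSemidef) :
      RevTest α (idTensor r N τ) (idTensor r E τ) (L * τ.trace.re) := by
    obtain ⟨v, hv⟩ := exists_sum_proj hτ
    rw [hv, ← idTensorLin_apply, ← idTensorLin_apply, map_sum, map_sum, Matrix.trace_sum,
      Complex.re_sum, Finset.mul_sum]
    exact RevTest.sum _ fun j _ => revTest_idTensor_proj h (v j)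
  obtain ⟨ι, _, s, τ, h1, h2, rfl, rfl, h5⟩ := hρ
  rw [← idTensorLin_apply, ← idTensorLin_apply, map_sum, map_sum]
  simp only [map_smul]
  -- Scaling only the first argument by `sᵢ` multiplies the cost `L tr τᵢ` by `sᵢ ^ α`, which
  -- reproduces `L` times the old cost.
  refine (RevTest.sum Finset.univ fun i _ => (hpsd (τ i) (h2 i)).smul_left (h1 i)).mono ?_
  refine le_trans (le_of_eq ?_) (mul_le_mul_of_nonneg_left h5 hL)
  rw [Finset.mul_sum]
  exact Finset.sum_congr rfl fun i _ => mul_left_comm _ _ _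

end Chain

/-! ### Completely positive maps -/

lemma IsCP.idTensor {A B : QSys} {E : SuperOp A B} (hE : IsCP E) {r : Type} [Finite r]
    {X : Matrix (r × A.Basis) (r × A.Basis) ℂ} (hX : X.PosSemidef) :
    (idTensor r E X).PosSemidef := by
  obtain ⟨m, ⟨e⟩⟩ := Finite.exists_equiv_fin r
  have h := hE m (X.submatrix (Prod.map e.symm id) (Prod.map e.symm id)) (hX.submatrix _)
  have h' : Magic.idTensor r E X = (Magic.idTensor (Fin m) E
      (X.submatrix (Prod.map e.symm id) (Prod.map e.symm id))).submatrix (Prod.map e id)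
      (Prod.map e id) := by
    ext i j
    simp [Magic.idTensor]
  rw [h']
  exact h.submatrix _

lemma IsCP.posSemidef {A B : QSys} {E : SuperOp A B} (hE : IsCP E) {X : Op A}
    (hX : X.PosSemidef) : (E X).PosSemidef := by
  have h := hE.idTensor (r := Unit) (hX.submatrix Prod.snd)
  exact h.submatrix fun b => ((), b)

lemma IsCP.applyRight {A B : QSys} {E : SuperOp A B} (hE : IsCP E) {R : QSys}
    {X : Op (R.tensor A)} (hX : X.PosSemidef) : (applyRight R E X).PosSemidef :=
  hE.idTensor (r := R.Basis) hX

lemma IsChannel.trace_applyRight {A B : QSys} {N : SuperOp A B} (hN : IsChannel N) (R : QSys)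
    (X : Op (R.tensor A)) : (applyRight R N X).trace = X.trace := by
  have h1 : (applyRight R N X).trace =
      ∑ i : R.Basis, (N (Matrix.of fun x y => X (i, x) (i, y))).trace :=
    Fintype.sum_prod_type (α₁ := R.Basis) (α₂ := B.Basis) _
  have h2 : X.trace = ∑ i : R.Basis, Matrix.trace (Matrix.of fun x y => X (i, x) (i, y) : Op A) :=
    Fintype.sum_prod_type (α₁ := R.Basis) (α₂ := A.Basis) _
  rw [h1, h2]
  exact Finset.sum_congr rfl fun i _ => hN.2 _

/-! ### Geometric Rényi divergence -/

lemma log2_ofReal {x : ℝ} (hx : 0 < x) :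
    log2 (ENNReal.ofReal x) = ((Real.log x / Real.log 2 : ℝ) : EReal) := by
  rw [log2, ENNReal.log_ofReal_of_pos hx, EReal.coe_div]

lemma log2_zero : log2 0 = ⊥ := by
  rw [log2, ENNReal.log_zero]
  exact EReal.bot_div_of_pos_ne_top (EReal.coe_pos.2 (Real.log_pos one_lt_two))
    (EReal.coe_ne_top _)

lemma log_two_pos : 0 < Real.log 2 := Real.log_pos one_lt_two

lemma le_rpow_of_log2_le {x c : ℝ} (h : log2 (ENNReal.ofReal x) ≤ (c : EReal)) :
    x ≤ (2 : ℝ) ^ c := by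
  rcases le_or_gt x 0 with hx | hx
  · exact hx.trans (Real.rpow_nonneg zero_le_two _)
  · rw [log2_ofReal hx, EReal.coe_le_coe_iff, div_le_iff₀ log_two_pos] at h
    rw [← Real.log_le_log_iff hx (Real.rpow_pos_of_pos two_pos _), Real.log_rpow two_pos]
    exact h

section Geo

variable {n : Type} [Fintype n] [DecidableEq n] {ρ σ : Matrix n n ℂ} {α : ℝ}

lemma revTest_of_geoDiv_le (hρ : ρ.PosSemidef) (hσ : σ.PosSemidef) (hα : 1 < α) {c : ℝ}
    (h : geoDiv α n ρ σ ≤ (c : EReal)) : RevTest α ρ σ ((2 : ℝ) ^ ((α - 1) * c)) := by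
  rw [geoDiv] at h
  split_ifs at h with hs
  · obtain ⟨κ, r, h1, h2, h3, h4, h5, -⟩ := exists_geometric_decomposition hρ hσ hs α
    refine ⟨n, inferInstance, r, κ, h2, h1, h3, h4, ?_⟩
    rw [← h5]
    refine le_rpow_of_log2_le ?_
    have hα' : 0 < α - 1 := sub_pos.2 hα
    have h6 := mul_le_mul_of_nonneg_left h (EReal.coe_nonneg.2 hα'.le)
    rw [← mul_assoc, ← EReal.coe_mul, mul_inv_cancel₀ hα'.ne', EReal.coe_one, one_mul,
      ← EReal.coe_mul] at h6
    exact h6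
  · exact absurd h (not_le.2 (EReal.coe_lt_top c))

lemma SuppLE.of_le (hρ : ρ.PosSemidef) {t : ℝ} (h : ((t : ℂ) • σ - ρ).PosSemidef) :
    SuppLE ρ σ := by
  intro v hv
  rw [← hρ.dotProduct_mulVec_zero_iff]
  have h1 := h.dotProduct_mulVec_nonneg v
  rw [Matrix.sub_mulVec, Matrix.smul_mulVec, hv, smul_zero, zero_sub, dotProduct_neg] at h1
  exact le_antisymm (neg_nonneg.1 h1) (hρ.dotProduct_mulVec_nonneg v)

/-- If `ρ ≤ t σ` then every ratio `rⱼ` is at most `t`, and `∑ rⱼ tr κⱼ = tr ρ = 1`, so the trace in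
the divergence is at most `t ^ (α - 1)`. -/
lemma geoDiv_le_maxDiv (hρ : ρ.PosSemidef) (htr : ρ.trace = 1) (hσ : σ.PosSemidef)
    (hα : 1 < α) : geoDiv α n ρ σ ≤ maxDiv n ρ σ := by
  refine le_iInf₂ fun t ht => ?_
  have hα' : 0 < α - 1 := sub_pos.2 hα
  have ht' : (((t : ℝ) : ℂ) • σ - ρ).PosSemidef := by
    have : ((t : ℝ) : ℂ) • σ = (t : ℝ) • σ := by
      ext i j
      simp
    rwa [this]
  have hs := SuppLE.of_le hρ ht'
  obtain ⟨κ, r, h1, h2, h3, h4, h5, h6⟩ := exists_geometric_decomposition hρ hσ hs α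
  rw [geoDiv, if_pos hs, h5]
  set T := ∑ j, r j ^ α * (κ j).trace.re with hT
  have hTle : T ≤ (t : ℝ) ^ (α - 1) := by
    have h7 : ∑ j, r j * (κ j).trace.re = 1 := by
      have := congrArg (fun X : Matrix n n ℂ => X.trace.re) h3
      simp only [htr, Matrix.trace_sum, Complex.re_sum, Matrix.trace_smul, smul_eq_mul,
        Complex.re_ofReal_mul, Complex.one_re] at this
      exact this.symm
    refine le_of_le_of_eq ?_ ((congrArg (fun x => (t : ℝ) ^ (α - 1) * x) h7).trans (mul_one _))
    simp only [Finset.mul_sum]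
    refine Finset.sum_le_sum fun j _ => ?_
    have h8 : r j ^ α = r j ^ (α - 1) * r j := by
      rw [← Real.rpow_add_one' (h2 j) (by linarith)]
      congr 1
      ring
    rw [h8, mul_assoc]
    exact mul_le_mul_of_nonneg_right
      (Real.rpow_le_rpow (h2 j) (h6 t t.2 ht' j) hα'.le)
      (mul_nonneg (h2 j) (trace_re_nonneg (h1 j)))
  rcases le_or_gt T 0 with hT0 | hT0
  · rw [ENNReal.ofReal_of_nonpos hT0, log2_zero, EReal.coe_mul_bot_of_pos (inv_pos.2 hα')]
    exact bot_le
  · have ht0 : 0 < (t : ℝ) := by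
      rcases t.2.eq_or_lt with h | h
      · rw [show (t : ℝ) = 0 from h.symm, Real.zero_rpow hα'.ne'] at hTle
        exact absurd hTle (not_le.2 hT0)
      · exact h
    have h9 := Real.log_le_log hT0 hTle
    rw [Real.log_rpow ht0] at h9
    rw [← ENNReal.ofReal_coe_nnreal, log2_ofReal hT0, log2_ofReal ht0, ← EReal.coe_mul,
      EReal.coe_le_coe_iff, ← mul_div_assoc]
    refine div_le_div_of_nonneg_right ?_ log_two_pos.le
    rw [inv_mul_le_iff₀ hα']
    exact h9

end Geo

lemma geoThauma_le_maxThauma {A B : QSys} {N : SuperOp A B} (hN : IsChannel N) {α : ℝ}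
    (hα : 1 < α) : geoThauma α N ≤ maxThauma N := by
  refine iInf₂_mono fun E hE => iSup₂_mono fun φ hφ => ?_
  have h := posSemidef_proj φ
  refine geoDiv_le_maxDiv (hN.1.applyRight h) ?_ (hE.1.applyRight h) hα
  rw [hN.trace_applyRight]
  exact (trace_proj φ).trans hφ

/-! ### Mana -/

lemma log2_mono {x y : ℝ≥0∞} (h : x ≤ y) : log2 x ≤ log2 y :=
  EReal.div_le_div_right_of_nonneg (EReal.coe_nonneg.2 log_two_pos.le) (ENNReal.log_monotone h)

lemma log2_ofReal_nonpos_iff {x : ℝ} : log2 (ENNReal.ofReal x) ≤ 0 ↔ x ≤ 1 := by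
  constructor
  · intro h
    simpa using le_rpow_of_log2_le (c := 0) h
  · intro h
    refine (log2_mono (ENNReal.ofReal_le_ofReal h)).trans_eq ?_
    rw [log2_ofReal one_pos]
    simp

lemma mem_manaFree_iff {S : QSys} {σ : Op S} :
    σ ∈ manaFree S ↔ σ.PosSemidef ∧ wignerTraceNorm σ ≤ 1 :=
  and_congr Iff.rfl log2_ofReal_nonpos_iff

lemma wignerTraceNorm_phasePoint_le_of_mem {A B : QSys} {E : SuperOp A B}
    (hE : E ∈ channelManaFree A B) (u : A.Phase) : wignerTraceNorm (E (phasePoint A u)) ≤ 1 := by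
  rw [← log2_ofReal_nonpos_iff]
  exact (log2_mono (le_iSup (fun u : A.Phase =>
    ENNReal.ofReal (wignerTraceNorm (E (phasePoint A u)))) u)).trans hE.2

lemma applyRight_mem_manaFree {A B : QSys} {E : SuperOp A B} (hE : E ∈ channelManaFree A B)
    {R : QSys} {σ : Op (R.tensor A)} (hσ : σ ∈ manaFree (R.tensor A)) :
    applyRight R E σ ∈ manaFree (R.tensor B) := by
  rw [mem_manaFree_iff] at hσ ⊢
  exact ⟨hE.1.applyRight hσ.1, (wignerTraceNorm_applyRight_le R
    (wignerTraceNorm_phasePoint_le_of_mem hE) hσ.1.1).trans hσ.2⟩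

lemma IsCPWP.map_mem_manaFree {A B : QSys} {F : SuperOp A B} (hF : IsCPWP F) {σ : Op A}
    (hσ : σ ∈ manaFree A) : F σ ∈ manaFree B := by
  rw [mem_manaFree_iff] at hσ ⊢
  exact ⟨hF.1.1.posSemidef hσ.1,
    (wignerTraceNorm_map_le hF.wignerTraceNorm_phasePoint_le hσ.1.1).trans hσ.2⟩

lemma one_mem_manaFree_unit : (1 : Op QSys.unit) ∈ manaFree QSys.unit := by
  rw [mem_manaFree_iff]
  have h := (isPhaseFrame_phasePoint QSys.unit).frameNorm_self ()
  have h1 : phasePoint QSys.unit () = 1 := by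
    change displaced (fun _ : Unit => (1 : Matrix Unit Unit ℂ)) () = 1
    simp [displaced]
  refine ⟨Matrix.PosSemidef.one, ?_⟩
  rw [wignerTraceNorm_eq_frameNorm, ← h1]
  exact h.le

/-! ### The strong converse bound in terms of reverse tests -/

/-- Replacing the channel by a completely positive map of non-positive mana in each round of a
protocol yields an operator of non-positive mana close to the output. -/
lemma Generates.exists_revTest {A B : QSys} {N E : SuperOp A B} (hN : IsChannel N)
    (hE : E ∈ channelManaFree A B) {α c : ℝ} (hα : 1 < α)
    (hc : channelDiv (geoDiv α) N E ≤ (c : EReal)) {n : ℕ} {X : QSys} {ω : Op X}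
    (h : Generates N n X ω) :
    ∃ σ ∈ manaFree X, RevTest α ω σ (((2 : ℝ) ^ ((α - 1) * c)) ^ n) := by
  have hL : 0 ≤ (2 : ℝ) ^ ((α - 1) * c) := Real.rpow_nonneg zero_le_two _
  have hpure (φ : A.Basis × A.Basis → ℂ) (hφ : star φ ⬝ᵥ φ = 1) :
      RevTest α (idTensor A.Basis N (proj φ)) (idTensor A.Basis E (proj φ))
        ((2 : ℝ) ^ ((α - 1) * c)) := by
    refine revTest_of_geoDiv_le (hN.1.idTensor (posSemidef_proj φ))
      (hE.1.idTensor (posSemidef_proj φ)) hα (le_trans ?_ hc)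
    exact le_iSup₂_of_le (f := fun (φ : (A.tensor A).Basis → ℂ) (_ : star φ ⬝ᵥ φ = 1) =>
      geoDiv α (A.tensor B).Basis (applyRight A N (proj φ)) (applyRight A E (proj φ))) φ hφ le_rfl
  have hmap {Y Z : QSys} {F : SuperOp Y Z} (hF : IsCPWP F) {ρ σ : Op Y} {C : ℝ}
      (h : RevTest α ρ σ C) : RevTest α (F ρ) (F σ) C :=
    h.map F (fun X hX => hF.1.1.posSemidef hX) fun X _ => by rw [hF.1.2]
  induction h with
  | start X F hF =>
    refine ⟨F 1, hF.map_mem_manaFree one_mem_manaFree_unit, ?_⟩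
    -- Before any use of the channel both protocols hold the same state, at cost one.
    have h := hmap hF (RevTest.refl (α := α) (Matrix.PosSemidef.one (n := QSys.unit.Basis)))
    refine h.mono (le_of_eq ?_)
    rw [Matrix.trace_one, pow_zero]
    have : Fintype.card QSys.unit.Basis = 1 := Fintype.card_unit
    rw [this]
    simp
  | @round n R ρ _ Y F hF ih =>
    obtain ⟨σ, hσ, hr⟩ := ih
    refine ⟨F (applyRight R E σ), hF.map_mem_manaFree (applyRight_mem_manaFree hE hσ), ?_⟩
    rw [pow_succ']
    exact hmap hF (RevTest.chain (r := R.Basis) hL hpure hr)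

/-! ### Duality for the overlap with operators of non-positive mana -/

section Duality

variable {n P : Type} [Fintype n] [DecidableEq n] [Fintype P] {A : P → Matrix n n ℂ}

/-- The operator with Wigner function `w`. -/
def ofWigner (A : P → Matrix n n ℂ) (w : P → ℝ) : Matrix n n ℂ := ∑ u, (w u : ℂ) • A u

lemma IsPhaseFrame.isHermitian_ofWigner (hA : IsPhaseFrame A) (w : P → ℝ) :
    (ofWigner A w).IsHermitian := by
  rw [ofWigner, Matrix.IsHermitian, Matrix.conjTranspose_sum]
  refine Finset.sum_congr rfl fun u _ => ?_
  rw [Matrix.conjTranspose_smul, (hA.isHermitian u).eq, Complex.star_def, Complex.conj_ofReal]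

lemma IsPhaseFrame.frameWigner_ofWigner (hA : IsPhaseFrame A) (w : P → ℝ) :
    frameWigner A (ofWigner A w) = w := by
  classical
  funext u
  rw [ofWigner, frameWigner_sum_smul]
  simp [hA.frameWigner_self]

lemma IsPhaseFrame.ofWigner_frameWigner (hA : IsPhaseFrame A) {V : Matrix n n ℂ}
    (hV : V.IsHermitian) : ofWigner A (frameWigner A V) = V :=
  (hA.expansion_of_isHermitian hV).symm

lemma re_trace_ofWigner_mul (w : P → ℝ) (X : Matrix n n ℂ) :
    (ofWigner A w * X).trace.re = ∑ u, w u * (A u * X).trace.re := by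
  simp only [ofWigner, Finset.sum_mul, Matrix.trace_sum, Complex.re_sum, Matrix.smul_mul,
    Matrix.trace_smul, smul_eq_mul, Complex.re_ofReal_mul]

lemma trace_mul_proj (X : Matrix n n ℂ) (v : n → ℂ) :
    (X * proj v).trace = star v ⬝ᵥ X *ᵥ v := by
  rw [proj, Matrix.mul_vecMulVec, Matrix.trace_vecMulVec, dotProduct_comm]

lemma posSemidef_of_trace_mul_proj {X : Matrix n n ℂ} (hX : X.IsHermitian)
    (h : ∀ v, 0 ≤ (X * proj v).trace.re) : X.PosSemidef := by
  refine .of_dotProduct_mulVec_nonneg hX fun v => ?_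
  rw [← trace_mul_proj]
  exact Complex.le_def.2 ⟨h v, (trace_mul_im_eq_zero hX (posSemidef_proj v).1).symm⟩

/-- Strong duality: an upper bound on the overlap with `X` of all positive semidefinite operators
of Wigner trace norm at most one is witnessed by an operator that dominates `X`. -/
lemma IsPhaseFrame.exists_dominating (hA : IsPhaseFrame A) {X : Matrix n n ℂ} {s s' : ℝ}
    (hs : ∀ σ : Matrix n n ℂ, σ.PosSemidef → frameNorm A σ ≤ 1 → (σ * X).trace.re ≤ s)
    (hss' : s < s') (hs' : 0 < s') :
    ∃ Q : Matrix n n ℂ, (Q - X).PosSemidef ∧ ∀ u, |(A u * Q).trace.re| ≤ s' := by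
  by_contra! hcon
  let ev (Q : Matrix n n ℂ) : P → ℝ := fun u => (A u * Q).trace.re
  let U : Set (P → ℝ) := Metric.ball 0 s'
  -- If no dominating `Q` exists, these dual coordinates avoid the open sup-norm ball. The
  -- coefficients of a separating functional then form the Wigner function of an operator that
  -- violates `hs`.
  let K : Set (P → ℝ) := {x | ∃ R : Matrix n n ℂ, R.PosSemidef ∧ x = ev (X + R)}
  have hev (Q Q' : Matrix n n ℂ) (c c' : ℝ) :
      ev ((c : ℂ) • Q + (c' : ℂ) • Q') = c • ev Q + c' • ev Q' := by
    funext u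
    simp only [ev, mul_add, Matrix.mul_smul, Matrix.trace_add, Matrix.trace_smul, smul_eq_mul,
      Complex.add_re, Complex.re_ofReal_mul, Pi.add_apply, Pi.smul_apply]
  have hK : Convex ℝ K := by
    rintro _ ⟨R, hR, rfl⟩ _ ⟨R', hR', rfl⟩ a b ha hb hab
    refine ⟨(a : ℂ) • R + (b : ℂ) • R',
      (posSemidef_ofReal_smul hR ha).add (posSemidef_ofReal_smul hR' hb), ?_⟩
    rw [← hev]
    congr 1
    have hab' : (a : ℂ) + (b : ℂ) = 1 := by exact_mod_cast hab
    calc (a : ℂ) • (X + R) + (b : ℂ) • (X + R')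
        = ((a : ℂ) + (b : ℂ)) • X + ((a : ℂ) • R + (b : ℂ) • R') := by module
      _ = _ := by rw [hab', one_smul]
  have hdisj : Disjoint U K := by
    rw [Set.disjoint_left]
    rintro _ hU ⟨R, hR, rfl⟩
    obtain ⟨u, hu⟩ := hcon (X + R) (by simpa using hR)
    have h1 : ‖ev (X + R)‖ < s' := by simpa [U] using hU
    exact absurd ((norm_le_pi_norm (ev (X + R)) u).trans_lt h1) (not_lt.2 hu.le)
  obtain ⟨f, t, hfU, hfK⟩ := geometric_hahn_banach_open (convex_ball 0 s') Metric.isOpen_ball hK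
    hdisj
  classical
  let w : P → ℝ := fun u => f (Pi.single u 1)
  have hf (x : P → ℝ) : f x = ∑ u, w u * x u := by
    have h := congrArg f (pi_eq_sum_univ' x)
    rw [map_sum] at h
    rw [h]
    refine Finset.sum_congr rfl fun u _ => ?_
    rw [map_smul, smul_eq_mul, mul_comm]
  have hfev (Q : Matrix n n ℂ) : f (ev Q) = (ofWigner A w * Q).trace.re := by
    rw [hf, re_trace_ofWigner_mul]
  have ht : 0 < t := by
    have := hfU 0 (Metric.mem_ball_self hs')
    rwa [map_zero] at this
  have hfX (R : Matrix n n ℂ) (hR : R.PosSemidef) :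
      t ≤ (ofWigner A w * X).trace.re + (ofWigner A w * R).trace.re := by
    have := hfK _ ⟨R, hR, rfl⟩
    rwa [hfev, mul_add, Matrix.trace_add, Complex.add_re] at this
  have hpsd : (ofWigner A w).PosSemidef := by
    refine posSemidef_of_trace_mul_proj (hA.isHermitian_ofWigner w) fun v => ?_
    by_contra! hneg
    set x := (ofWigner A w * X).trace.re with hx
    set y := (ofWigner A w * proj v).trace.re with hy
    -- With this multiple of `proj v`, the quantity bounded below by `t > 0` becomes `x - |x| ≤ 0`.
    have h0 : 0 ≤ |x| / -y := div_nonneg (abs_nonneg _) (by linarith)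
    have h1 := hfX _ (posSemidef_ofReal_smul (posSemidef_proj v) h0)
    rw [Matrix.mul_smul, Matrix.trace_smul, smul_eq_mul, Complex.re_ofReal_mul, ← hy] at h1
    have h2 : |x| / -y * y = -|x| := by
      rw [div_mul_eq_mul_div, div_neg, mul_div_cancel_right₀ _ hneg.ne]
    rw [h2] at h1
    linarith [le_abs_self x]
  have hxt := hfX 0 Matrix.PosSemidef.zero
  rw [mul_zero, Matrix.trace_zero, Complex.zero_re, add_zero] at hxt
  have hnorm : frameNorm A (ofWigner A w) = ∑ u, |w u| := by
    rw [frameNorm, hA.frameWigner_ofWigner]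
  have hwt : s' * ∑ u, |w u| ≤ t := by
    by_contra! hlt
    have hW : 0 < ∑ u, |w u| := pos_of_mul_pos_right (ht.trans hlt) hs'.le
    set q := t / ∑ u, |w u| with hq
    have hq0 : 0 < q := div_pos ht hW
    have hqs : q < s' := (div_lt_iff₀ hW).2 hlt
    -- The dual of the sup norm is the `ℓ¹` norm. This sign vector lies in the ball, yet `f` takes
    -- exactly the value `t` there.
    have h1 := hfU (fun u => q * SignType.sign (w u)) (by
      rw [mem_ball_zero_iff, pi_norm_lt_iff hs']
      intro u
      rw [Real.norm_eq_abs, abs_mul, abs_of_pos hq0]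
      refine lt_of_le_of_lt (mul_le_of_le_one_right hq0.le ?_) hqs
      rcases SignType.sign (w u) with _ | _ | _ <;> simp)
    have h2 : f (fun u => q * SignType.sign (w u)) = t := by
      rw [hf]
      simp only [mul_left_comm _ q, self_mul_sign]
      rw [← Finset.mul_sum, hq, div_mul_cancel₀ _ hW.ne']
    exact absurd h1 (by rw [h2]; exact lt_irrefl t)
  set W := ∑ u, |w u| with hW
  have hWpos : 0 < W := by
    refine lt_of_le_of_ne (Finset.sum_nonneg fun u _ => abs_nonneg _) fun h0 => ?_
    have h1 : ∀ u, w u = 0 := fun u => abs_eq_zero.1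
      ((Finset.sum_eq_zero_iff_of_nonneg fun u _ => abs_nonneg _).1 h0.symm u (Finset.mem_univ u))
    rw [re_trace_ofWigner_mul] at hxt
    simp only [h1, zero_mul, Finset.sum_const_zero] at hxt
    linarith
  -- Normalized, the separating operator has overlap at least `t / W ≥ s' > s`.
  have h3 := hs (((W⁻¹ : ℝ) : ℂ) • ofWigner A w)
    (posSemidef_ofReal_smul hpsd (inv_nonneg.2 hWpos.le)) (by
      rw [frameNorm_smul (inv_nonneg.2 hWpos.le), hnorm, inv_mul_cancel₀ hWpos.ne'])
  rw [Matrix.smul_mul, Matrix.trace_smul, smul_eq_mul, Complex.re_ofReal_mul,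
    inv_mul_le_iff₀ hWpos] at h3
  have h4 := mul_lt_mul_of_pos_right hss' hWpos
  linarith

end Duality

/-! ### Multiplicativity of the overlap bound under tensor powers -/

section Copies

/-- Shows that domination `X ≥ X'`, `Y ≥ Y'` passes to Kronecker products when `Y` and `X'` are
positive semidefinite. -/
lemma kronecker_sub_kronecker {m n : Type} (X X' : Matrix m m ℂ) (Y Y' : Matrix n n ℂ) :
    X ⊗ₖ Y - X' ⊗ₖ Y' = (X - X') ⊗ₖ Y + X' ⊗ₖ (Y - Y') := by
  ext i j
  simp only [Matrix.sub_apply, Matrix.add_apply, Matrix.kroneckerMap_apply]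
  ring

variable {S : QSys} {ψ : S.Basis → ℂ}

lemma exists_dominating_copies {Q : Op S} {s : ℝ} (hQ : (Q - proj ψ).PosSemidef)
    (hs : ∀ u, |(phasePoint S u * Q).trace.re| ≤ s) (k : ℕ) :
    ∃ Q' : Op (S.pow k), (Q' - proj (copies ψ k)).PosSemidef ∧
      ∀ u, |(phasePoint (S.pow k) u * Q').trace.re| ≤ s ^ k := by
  have hQ0 : Q.PosSemidef := by
    have := hQ.add (posSemidef_proj ψ)
    rwa [sub_add_cancel] at this
  have hs0 : 0 ≤ s := (abs_nonneg _).trans (hs S.origin)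
  induction k with
  | zero =>
    refine ⟨proj (copies ψ 0), ?_, fun u => ?_⟩
    · rw [sub_self]
      exact Matrix.PosSemidef.zero
    · have h (u : Unit) : |(displaced (fun _ : Unit => (1 : Matrix Unit Unit ℂ)) u *
          proj fun _ : Unit => (1 : ℂ)).trace.re| ≤ s ^ 0 := by
        simp [displaced, Matrix.trace, proj_apply]
      exact h u
  | succ k ih =>
    obtain ⟨Q', h1, h2⟩ := ih
    refine ⟨(Q' ⊗ₖ Q : Matrix ((S.pow k).Basis × S.Basis) _ ℂ), ?_, fun u => ?_⟩
    · have h3 : (Q' ⊗ₖ Q - proj (copies ψ k) ⊗ₖ proj ψ).PosSemidef := by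
        have h4 := (h1.kronecker hQ0).add ((posSemidef_proj (copies ψ k)).kronecker hQ)
        rwa [← kronecker_sub_kronecker] at h4
      have h5 : (proj (copies ψ k) ⊗ₖ proj ψ : Matrix ((S.pow k).Basis × S.Basis) _ ℂ) =
          proj (fun x : (S.pow k).Basis × S.Basis => copies ψ k x.1 * ψ x.2) := by
        ext i j
        simp only [Matrix.kroneckerMap_apply, proj_apply, star_mul']
        ring
      rw [h5] at h3
      exact h3
    · have hQ' : Q'.IsHermitian := by
        have := (h1.add (posSemidef_proj (copies ψ k))).1
        rwa [sub_add_cancel] at this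
      have h3 (v : (S.pow k).Phase × S.Phase) :
          |(kronFamily (phasePoint (S.pow k)) (phasePoint S) v * (Q' ⊗ₖ Q)).trace.re| ≤
            s ^ (k + 1) := by
        have him := trace_mul_im_eq_zero ((isPhaseFrame_phasePoint (S.pow k)).isHermitian v.1) hQ'
        rw [kronFamily, ← Matrix.mul_kronecker_mul, Matrix.trace_kronecker, Complex.mul_re, him,
          zero_mul, sub_zero, abs_mul, pow_succ]
        exact mul_le_mul (h2 v.1) (hs v.2) (abs_nonneg _) (pow_nonneg hs0 k)
      rw [← phasePoint_tensor] at h3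
      exact h3 u

/-- Multiplicativity of the largest overlap of copies of a pure state with operators of
non-positive mana. -/
lemma re_trace_mul_proj_copies_le {s : ℝ} (hs0 : 0 < s)
    (hs : ∀ σ ∈ manaFree S, (σ * proj ψ).trace.re ≤ s) (k : ℕ) {σ : Op (S.pow k)}
    (hσ : σ ∈ manaFree (S.pow k)) : (σ * proj (copies ψ k)).trace.re ≤ s ^ k := by
  -- The duality lemma needs strict slack, which is removed by letting `s'` decrease to `s`.
  have key (s' : ℝ) (hs' : s < s') : (σ * proj (copies ψ k)).trace.re ≤ s' ^ k := by
    have hS := isPhaseFrame_phasePoint S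
    have hSk := isPhaseFrame_phasePoint (S.pow k)
    obtain ⟨Q, hQ, hQs⟩ := hS.exists_dominating (X := proj ψ)
      (fun σ h1 h2 => hs σ (mem_manaFree_iff.2 ⟨h1, h2⟩)) hs' (hs0.trans hs')
    obtain ⟨Q', hQ', hQs'⟩ := exists_dominating_copies hQ hQs k
    rw [mem_manaFree_iff] at hσ
    have h1 := posSemidef_trace_mul_re_nonneg hσ.1 hQ'
    rw [mul_sub, Matrix.trace_sub, Complex.sub_re, sub_nonneg] at h1
    refine h1.trans ?_
    -- Weak duality: the Wigner function of `σ` has `ℓ¹` norm at most one, and the coordinates of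
    -- `Q'` are at most `s' ^ k` in absolute value.
    have h2 : (σ * Q').trace.re = ∑ u, wigner σ u * (phasePoint (S.pow k) u * Q').trace.re := by
      rw [wigner_eq_frameWigner, ← re_trace_ofWigner_mul, hSk.ofWigner_frameWigner hσ.1.1]
    rw [h2]
    calc _ ≤ ∑ u, |wigner σ u| * s' ^ k := by
          refine Finset.sum_le_sum fun u _ => (le_abs_self _).trans ?_
          rw [abs_mul]
          exact mul_le_mul_of_nonneg_left (hQs' u) (abs_nonneg _)
      _ = wignerTraceNorm σ * s' ^ k := by rw [← Finset.sum_mul]; rfl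
      _ ≤ 1 * s' ^ k :=
          mul_le_mul_of_nonneg_right hσ.2 (pow_nonneg (hs0.trans hs').le _)
      _ = s' ^ k := one_mul _
  have hcont : Filter.Tendsto (fun x : ℝ => x ^ k) (nhdsWithin s (Set.Ioi s)) (nhds (s ^ k)) :=
    ((continuous_pow k).tendsto s).mono_left nhdsWithin_le_nhds
  exact ge_of_tendsto hcont (eventually_nhdsWithin_of_forall fun x hx => key x hx)

end Copies

/-! ### The min-Thauma of a pure magic state -/

section Min

variable {S : QSys} {ψ : S.Basis → ℂ}

lemma proj_mul_proj {n : Type} [Fintype n] {ψ : n → ℂ} (hψ : star ψ ⬝ᵥ ψ = 1) :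
    proj ψ * proj ψ = proj ψ := by
  rw [proj, Matrix.vecMulVec_mul_vecMulVec, hψ]
  simp

lemma suppProj_proj {n : Type} [Fintype n] [DecidableEq n] {ψ : n → ℂ} (hψ : star ψ ⬝ᵥ ψ = 1) :
    suppProj (proj ψ) = proj ψ := by
  have hidem : IsIdempotentElem (proj ψ) := proj_mul_proj hψ
  have hspec : spectrum ℝ (proj ψ) ⊆ {0, 1} := hidem.spectrum_subset ℝ
  conv_rhs => rw [← cfc_id_eq (posSemidef_proj ψ).1]
  refine cfc_congr fun x hx => ?_
  rcases hspec hx with h | h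
  · rw [h]
    simp
  · rw [Set.mem_singleton_iff.1 h]
    simp

lemma posSemidef_one_sub_proj {n : Type} [Fintype n] [DecidableEq n] {ψ : n → ℂ}
    (hψ : star ψ ⬝ᵥ ψ = 1) : (1 - proj ψ).PosSemidef := by
  rw [← suppProj_proj hψ]
  exact posSemidef_one_sub_suppProj _

/-- A positive semidefinite operator of trace at most one with unit overlap with a pure state is
that pure state. -/
lemma eq_proj_of_overlap {n : Type} [Fintype n] [DecidableEq n] {ψ : n → ℂ}
    (hψ : star ψ ⬝ᵥ ψ = 1) {σ : Matrix n n ℂ} (hσ : σ.PosSemidef) (htr : σ.trace.re ≤ 1)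
    (h : 1 ≤ (σ * proj ψ).trace.re) : σ = proj ψ := by
  have hP := posSemidef_one_sub_proj hψ
  have hPP : (1 - proj ψ) * (1 - proj ψ) = 1 - proj ψ := by
    rw [mul_sub, sub_mul, sub_mul, proj_mul_proj hψ]
    simp
  set g := matPow σ (1 / 2) with hg
  have hgH : gᴴ = g := isHermitian_cfc _ _
  have hgg : g * g = σ := matPow_half_mul_self hσ
  have h0 : (σ * (1 - proj ψ)).trace.re = 0 := by
    refine le_antisymm ?_ (posSemidef_trace_mul_re_nonneg hσ hP)
    rw [mul_sub, mul_one, Matrix.trace_sub, Complex.sub_re]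
    linarith
  have h1 : ((g * (1 - proj ψ))ᴴ * (g * (1 - proj ψ))).trace = 0 := by
    have : ((g * (1 - proj ψ))ᴴ * (g * (1 - proj ψ))).trace = (σ * (1 - proj ψ)).trace := by
      rw [Matrix.conjTranspose_mul, hP.1.eq, hgH, mul_assoc, ← mul_assoc g, hgg,
        Matrix.trace_mul_comm, mul_assoc, hPP]
    rw [this]
    exact Complex.ext h0 (trace_mul_im_eq_zero hσ.1 hP.1)
  rw [Matrix.trace_conjTranspose_mul_self_eq_zero_iff] at h1
  have h2 : σ = σ * proj ψ := by
    have : σ * (1 - proj ψ) = 0 := by rw [← hgg, mul_assoc, h1, mul_zero]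
    rwa [mul_sub, mul_one, sub_eq_zero] at this
  have h3 : σ = proj ψ * σ := by
    have := congrArg Matrix.conjTranspose h2
    rwa [Matrix.conjTranspose_mul, hσ.1.eq, (posSemidef_proj ψ).1.eq] at this
  have h4 : σ = (σ * proj ψ).trace • proj ψ := by
    rw [trace_mul_proj]
    conv_lhs => rw [h3, h2]
    rw [proj, Matrix.mul_vecMulVec, Matrix.vecMulVec_mul_vecMulVec,
      Matrix.vecMulVec_smul]
  have h5 : (σ * proj ψ).trace = 1 := by
    have h6 := h2 ▸ htr
    exact Complex.ext (le_antisymm h6 h) (trace_mul_im_eq_zero hσ.1 (posSemidef_proj ψ).1)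
  rw [h4, h5, one_smul]

/-- The Wigner function sums to one, and a negative value makes the absolute sum strictly larger. -/
lemma one_lt_wignerTraceNorm (hψ : IsMagic ψ) : 1 < wignerTraceNorm (proj ψ) := by
  have h1 := (isPhaseFrame_phasePoint S).sum_frameWigner (proj ψ)
  rw [trace_proj, hψ.1, Complex.one_re] at h1
  rw [← h1]
  obtain ⟨u, hu⟩ := hψ.2
  exact Finset.sum_lt_sum (fun v _ => le_abs_self _)
    ⟨u, Finset.mem_univ u, hu.trans_le (abs_nonneg _)⟩

/-- The mana-free operators form a compact set, so the overlap attains its maximum. The value one is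
excluded because the maximizer would be `proj ψ` itself. -/
lemma exists_overlap_bound (hψ : IsMagic ψ) :
    ∃ s : ℝ, 0 < s ∧ s < 1 ∧ ∀ σ ∈ manaFree S, (σ * proj ψ).trace.re ≤ s := by
  have hS := isPhaseFrame_phasePoint S
  let K : Set (S.Phase → ℝ) :=
    {w | ∑ u, |w u| ≤ 1 ∧ (ofWigner (phasePoint S) w).PosSemidef}
  have hcont : Continuous (ofWigner (phasePoint S)) := by
    unfold ofWigner
    fun_prop
  have hoverlap (v : S.Basis → ℂ) :
      Continuous fun w => (ofWigner (phasePoint S) w * proj v).trace.re :=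
    Complex.continuous_re.comp ((hcont.matrix_mul continuous_const).matrix_trace)
  have hclosed : IsClosed K := by
    -- Positivity is an intersection of closed half-spaces, one for each vector `v`.
    have hK : K = {w | ∑ u, |w u| ≤ 1} ∩
        ⋂ v, {w | 0 ≤ (ofWigner (phasePoint S) w * proj v).trace.re} := by
      ext w
      simp only [K, Set.mem_inter_iff, Set.mem_iInter, Set.mem_ofPred_eq]
      exact and_congr Iff.rfl ⟨fun h v => posSemidef_trace_mul_re_nonneg h (posSemidef_proj v),
        posSemidef_of_trace_mul_proj (hS.isHermitian_ofWigner w)⟩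
    rw [hK]
    exact (isClosed_le (by fun_prop) continuous_const).inter
      (isClosed_iInter fun v => isClosed_le continuous_const (hoverlap v))
  have hbdd : K ⊆ Metric.closedBall 0 1 := by
    intro w hw
    rw [mem_closedBall_zero_iff, pi_norm_le_iff_of_nonneg zero_le_one]
    exact fun u => (Finset.single_le_sum (f := fun u => |w u|) (fun _ _ => abs_nonneg _)
      (Finset.mem_univ u)).trans hw.1
  have hcomp : IsCompact K := (isCompact_closedBall 0 1).of_isClosed_subset hclosed hbdd
  have hne : K.Nonempty := ⟨0, by simp, by simpa [ofWigner] using Matrix.PosSemidef.zero⟩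
  obtain ⟨w, hw, hmax⟩ := hcomp.exists_isMaxOn hne (hoverlap ψ).continuousOn
  set s := (ofWigner (phasePoint S) w * proj ψ).trace.re with hs
  have hlt : s < 1 := by
    by_contra! hge
    have hnorm : wignerTraceNorm (ofWigner (phasePoint S) w) ≤ 1 := by
      rw [wignerTraceNorm_eq_frameNorm, frameNorm, hS.frameWigner_ofWigner]
      exact hw.1
    have heq := eq_proj_of_overlap hψ.1 hw.2 ((hS.trace_re_le _).trans hnorm) hge
    rw [heq] at hnorm
    exact absurd hnorm (not_le.2 (one_lt_wignerTraceNorm hψ))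
  -- The value `1 / 2` only guarantees a positive bound, whose logarithm is finite.
  refine ⟨max s (1 / 2), lt_max_of_lt_right one_half_pos, max_lt hlt one_half_lt_one,
    fun σ hσ => le_max_of_le_left ?_⟩
  rw [mem_manaFree_iff] at hσ
  have h1 : wigner σ ∈ K := ⟨hσ.2, by
    rw [wigner_eq_frameWigner, hS.ofWigner_frameWigner hσ.1.1]
    exact hσ.1⟩
  have h2 := hmax h1
  simp only [Set.mem_ofPred_eq, wigner_eq_frameWigner, hS.ofWigner_frameWigner hσ.1.1] at h2
  exact h2

lemma minThauma_pos (hψ : IsMagic ψ) : 0 < minThauma (proj ψ) := by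
  obtain ⟨s, hs0, hs1, hs⟩ := exists_overlap_bound hψ
  have h1 : (0 : EReal) < ((-(Real.log s / Real.log 2) : ℝ) : EReal) := by
    rw [EReal.coe_pos, neg_pos]
    exact div_neg_of_neg_of_pos (Real.log_neg hs0 hs1) log_two_pos
  refine h1.trans_le (le_iInf₂ fun σ hσ => ?_)
  rw [minDiv, suppProj_proj hψ.1, EReal.coe_neg, EReal.neg_le_neg_iff, ← log2_ofReal hs0,
    Matrix.trace_mul_comm]
  exact log2_mono (ENNReal.ofReal_le_ofReal (hs σ hσ))

/-- The maximally mixed state is mana-free and has overlap `1 / d` with every pure state. -/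
lemma minThauma_lt_top (hψ : star ψ ⬝ᵥ ψ = 1) : minThauma (proj ψ) < ⊤ := by
  have hS := isPhaseFrame_phasePoint S
  have hd : (0 : ℝ) < Fintype.card S.Basis := Nat.cast_pos.2 hS.card_pos
  set c : ℝ := (Fintype.card S.Basis : ℝ)⁻¹ with hc
  have hc0 : 0 < c := inv_pos.2 hd
  have hmem : (c : ℂ) • (1 : Op S) ∈ manaFree S := by
    rw [mem_manaFree_iff]
    refine ⟨posSemidef_ofReal_smul Matrix.PosSemidef.one hc0.le, ?_⟩
    rw [wignerTraceNorm_eq_frameNorm, frameNorm_smul hc0.le, hS.frameNorm_eq_trace]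
    · rw [Matrix.trace_one, Complex.natCast_re, hc, inv_mul_cancel₀ hd.ne']
    · intro u
      rw [frameWigner, mul_one, hS.trace_eq_one, Complex.one_re]
      positivity
  refine (iInf₂_le _ hmem).trans_lt ?_
  rw [minDiv, suppProj_proj hψ, Matrix.mul_smul, mul_one, Matrix.trace_smul, trace_proj, hψ,
    smul_eq_mul, mul_one, Complex.ofReal_re, log2_ofReal hc0, ← EReal.coe_neg]
  exact EReal.coe_lt_top _

lemma re_trace_mul_proj_le_of_le_minThauma (hψ : star ψ ⬝ᵥ ψ = 1) {θ : ℝ}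
    (hθ : (θ : EReal) ≤ minThauma (proj ψ)) {σ : Op S} (hσ : σ ∈ manaFree S) :
    (σ * proj ψ).trace.re ≤ (2 : ℝ) ^ (-θ) := by
  have h1 := hθ.trans (iInf₂_le σ hσ)
  rw [minDiv, suppProj_proj hψ, Matrix.trace_mul_comm] at h1
  refine le_rpow_of_log2_le ?_
  rw [EReal.coe_neg]
  exact EReal.le_neg_of_le_neg h1

end Min

/-! ### Capacities -/

lemma copies_normalized {S : QSys} {ψ : S.Basis → ℂ} (hψ : star ψ ⬝ᵥ ψ = 1) (k : ℕ) :
    star (copies ψ k) ⬝ᵥ copies ψ k = 1 := by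
  induction k with
  | zero =>
    have h : star (fun _ : Unit => (1 : ℂ)) ⬝ᵥ (fun _ : Unit => (1 : ℂ)) = 1 := by simp
    exact h
  | succ k ih =>
    have h : star (fun x : (S.pow k).Basis × S.Basis => copies ψ k x.1 * ψ x.2) ⬝ᵥ
        (fun x : (S.pow k).Basis × S.Basis => copies ψ k x.1 * ψ x.2) = 1 := by
      rw [dotProduct, Fintype.sum_prod_type]
      simp only [Pi.star_apply, star_mul', mul_mul_mul_comm (star (copies ψ k _))]
      rw [← Finset.sum_mul_sum]
      have h1 : ∑ i, star (copies ψ k i) * copies ψ k i = 1 := ih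
      have h2 : ∑ i, star (ψ i) * ψ i = 1 := hψ
      rw [h1, h2, one_mul]
    exact h

lemma capacity_le_strongCapacity {A B S : QSys} (N : SuperOp A B) (ψ : S.Basis → ℂ) :
    capacity N ψ ≤ strongCapacity N ψ := by
  refine sSup_le ?_
  rintro _ ⟨r, rfl, hr⟩
  refine le_sInf ?_
  rintro _ ⟨r₀, rfl, hr₀⟩
  rw [EReal.coe_le_coe_iff]
  by_contra! hlt
  -- At the midpoint of `r₀` and `r`, achievability gives fidelity at least `1 / 2`, while the
  -- strong converse caps it at `1 / 4`.
  obtain ⟨n₁, h₁⟩ := hr (1 / 2) (by norm_num) (by norm_num) ((r - r₀) / 2) (by linarith)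
  obtain ⟨n₂, h₂⟩ := hr₀ (r - (r - r₀) / 2) (by linarith) (1 / 4) (by norm_num)
  obtain ⟨k, hk, ω, hω, hfid⟩ := h₁ (max n₁ n₂) (le_max_left _ _)
  have := h₂ (max n₁ n₂) (le_max_right _ _) k hk ω hω
  linarith

/-- The fidelity of a protocol is exponentially small in the number of rounds when the rate exceeds
the ratio of the Thaumas. -/
lemma Generates.fidelity_le {A B S : QSys} {N E : SuperOp A B} (hN : IsChannel N)
    (hE : E ∈ channelManaFree A B) {α c θ r : ℝ} (hα : 1 < α)
    (hc : channelDiv (geoDiv α) N E ≤ (c : EReal)) {ψ : S.Basis → ℂ} (hψ : star ψ ⬝ᵥ ψ = 1)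
    (hθ0 : 0 ≤ θ) (hθ : (θ : EReal) ≤ minThauma (proj ψ)) {n k : ℕ} (hk : (n : ℝ) * r ≤ k)
    {ω : Op (S.pow k)} (hω : Generates N n (S.pow k) ω) :
    fidelity ψ k ω ≤ ((2 : ℝ) ^ ((1 - α⁻¹) * (c - θ * r))) ^ n := by
  obtain ⟨σ, hσ, hrev⟩ := hω.exists_revTest hN hE hα hc
  have hα0 : 0 < α := one_pos.trans hα
  have hα1 : 0 ≤ 1 - α⁻¹ := sub_nonneg.2 (inv_le_one_of_one_le₀ hα.le)
  have h1 := hrev.trace_mul_le hα (posSemidef_proj (copies ψ k))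
    (posSemidef_one_sub_proj (copies_normalized hψ k))
  have h2 : (σ * proj (copies ψ k)).trace.re ≤ (2 : ℝ) ^ (-θ * (n * r)) := by
    refine (re_trace_mul_proj_copies_le (Real.rpow_pos_of_pos two_pos _)
      (fun σ hσ => re_trace_mul_proj_le_of_le_minThauma hψ hθ hσ) k hσ).trans ?_
    rw [← Real.rpow_mul_natCast zero_le_two]
    exact Real.rpow_le_rpow_of_exponent_le one_le_two
      (mul_le_mul_of_nonpos_left hk (neg_nonpos.2 hθ0))
  have h3 := Real.rpow_le_rpow (posSemidef_trace_mul_re_nonneg (mem_manaFree_iff.1 hσ).1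
    (posSemidef_proj (copies ψ k))) h2 hα1
  refine h1.trans ((mul_le_mul_of_nonneg_right h3
    (Real.rpow_nonneg (pow_nonneg (Real.rpow_nonneg zero_le_two _) _) _)).trans (le_of_eq ?_))
  rw [← Real.rpow_mul_natCast zero_le_two, ← Real.rpow_mul_natCast zero_le_two,
    ← Real.rpow_mul zero_le_two, ← Real.rpow_mul zero_le_two, ← Real.rpow_add two_pos]
  congr 1
  field_simp
  ring

lemma strongCapacity_le {A B S : QSys} {N : SuperOp A B} (hN : IsChannel N) {α : ℝ}
    (hα : 1 < α) {ψ : S.Basis → ℂ} (hψ : IsMagic ψ) :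
    strongCapacity N ψ ≤ geoThauma α N / minThauma (proj ψ) := by
  have hpos := minThauma_pos hψ
  have htop := minThauma_lt_top hψ.1
  obtain ⟨θ, hθ⟩ : ∃ θ : ℝ, minThauma (proj ψ) = θ :=
    ⟨_, (EReal.coe_toReal htop.ne (hpos.trans' EReal.bot_lt_zero).ne').symm⟩
  rw [hθ] at hpos ⊢
  have hθ0 : 0 < θ := EReal.coe_pos.1 hpos
  -- It suffices that every real `r₀` above the ratio is a strong converse rate; this also covers
  -- infinite ratios.
  refine EReal.le_of_forall_lt_iff_le.1 fun r₀ hr₀ => ?_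
  refine sInf_le ⟨r₀, rfl, fun r hr η hη => ?_⟩
  have hlt : geoThauma α N < ((r * θ : ℝ) : EReal) := by
    rw [EReal.coe_mul]
    exact (EReal.div_lt_iff hpos (EReal.coe_ne_top θ)).1
      (hr₀.trans (EReal.coe_lt_coe_iff.2 hr))
  simp only [geoThauma, channelThauma, iInf_lt_iff] at hlt
  obtain ⟨E, hE, hlt'⟩ := hlt
  -- A real `c` between the divergence and `r θ` makes the exponent `c - θ r` negative even if the
  -- divergence is `-∞`.
  obtain ⟨c, hc1, hc2⟩ := EReal.lt_iff_exists_real_btwn.1 hlt'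
  rw [EReal.coe_lt_coe_iff] at hc2
  have hβ : (2 : ℝ) ^ ((1 - α⁻¹) * (c - θ * r)) < 1 := by
    refine Real.rpow_lt_one_of_one_lt_of_neg one_lt_two (mul_neg_of_pos_of_neg ?_ ?_)
    · exact sub_pos.2 (inv_lt_one_of_one_lt₀ hα)
    · linarith
  obtain ⟨n₀, hn₀⟩ := exists_pow_lt_of_lt_one hη hβ
  refine ⟨n₀, fun n hn k hk ω hω => ?_⟩
  refine (hω.fidelity_le hN hE hα hc1.le hψ.1 hθ0.le hθ.ge hk).trans
    (le_trans ?_ hn₀.le)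
  exact pow_le_pow_of_le_one (Real.rpow_nonneg zero_le_two _) hβ.le hn

end Magic

end

theorem mainTheorem8 (A B S : Magic.QSys) (N : Magic.SuperOp A B) (hN : Magic.IsChannel N)
    (α : ℝ) (hα₁ : 1 < α) (hα₂ : α ≤ 2) (ψ : S.Basis → ℂ) (hψ : Magic.IsMagic ψ) :
    (0 < Magic.minThauma (Magic.proj ψ) ∧ Magic.minThauma (Magic.proj ψ) < ⊤) ∧
    Magic.capacity N ψ ≤ Magic.strongCapacity N ψ ∧
    Magic.strongCapacity N ψ ≤ Magic.geoThauma α N / Magic.minThauma (Magic.proj ψ) ∧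
    Magic.geoThauma α N / Magic.minThauma (Magic.proj ψ) ≤
      Magic.maxThauma N / Magic.minThauma (Magic.proj ψ) :=
  ⟨⟨Magic.minThauma_pos hψ, Magic.minThauma_lt_top hψ.1⟩,
    Magic.capacity_le_strongCapacity N ψ, Magic.strongCapacity_le hN hα₁ hψ,
    EReal.div_le_div_right_of_nonneg (Magic.minThauma_pos hψ).le
      (Magic.geoThauma_le_maxThauma hN hα₁)⟩
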